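/- For integers $n\ge 2$ and $1\le m<n^2$, and for a digit set $\mathcal D\subsetneq\{0,1,\dots,n-1\}^2$ with $\#\mathcal D=m$, let $F\subset\mathbb R^2$ be the unique nonempty compact set satisfying $$F=\bigcup_{d\in\mathcal D}\tfrac1n(F+d);$$ such an $F$ is called a fractal square, and $\mathcal F_{n,m}$ denotes the collection of all fractal squares obtained from digit sets $\mathcal D\subsetneq\{0,1,\dots,n-1\}^2$ with $\#\mathcal D=m$. Two sets $E,F\subset\mathbb R^2$ are Lipschitz equivalent, written $E\simeq F$, if there are a bijection $g:E\to F$ and a constant $C>0$ such that $C^{-1}|x-y|\le|g(x)-g(y)|\le C|x-y|$ for all $x,y\in E$. Write $\#(\mathcal F_{n,m}/{\simeq})$ for the number of Lipschitz equivalence classes in $\mathcal F_{n,m}$. **Theorem.** $$\#(\mathcal F_{3,2}/{\simeq})=1,\qquad \#(\mathcal F_{3,3}/{\simeq})=\#(\mathcal F_{3,4}/{\simeq})=2,\qquad \#(\mathcal F_{3,5}/{\simeq})\le 10.$$ -/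

import Mathlib

/-- The Euclidean plane `ℝ²`. -/
abbrev Plane : Type := EuclideanSpace ℝ (Fin 2)

/-- The contraction `x ↦ (x + d) / n` of the plane attached to the digit `d`. -/
noncomputable def digitMap (n : ℕ) (d : ℕ × ℕ) (x : Plane) : Plane :=
  (n : ℝ)⁻¹ • (x + !₂[(d.1 : ℝ), (d.2 : ℝ)])

/-- `F` is the self-similar set of the digit set `D`: the (unique, when `n ≥ 2` and `D ≠ ∅`)
nonempty compact set with `F = ⋃_{d ∈ D} (F + d) / n`. -/
def IsSelfSimilarSet (n : ℕ) (D : Finset (ℕ × ℕ)) (F : Set Plane) : Prop :=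
  F.Nonempty ∧ IsCompact F ∧ F = ⋃ d ∈ D, digitMap n d '' F

/-- The collection `𝓕_{n,m}` of all fractal squares whose digit set is a proper subset of
`{0, …, n-1}²` with exactly `m` elements. -/
def fractalSquares (n m : ℕ) : Set (Set Plane) :=
  {F | ∃ D : Finset (ℕ × ℕ), D ⊂ Finset.range n ×ˢ Finset.range n ∧ D.card = m ∧
    IsSelfSimilarSet n D F}

/-- Lipschitz equivalence of two subsets of the plane: there is a bijection `g` from `E` onto `F`
and a constant `C > 0` with `C⁻¹ |x - y| ≤ |g x - g y| ≤ C |x - y|` on `E`. -/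
def LipschitzEquivalent (E F : Set Plane) : Prop :=
  ∃ g : E → F, Function.Bijective g ∧ ∃ C : ℝ, 0 < C ∧
    ∀ x y : E, C⁻¹ * dist x y ≤ dist (g x) (g y) ∧ dist (g x) (g y) ≤ C * dist x y

theorem LipschitzEquivalent.refl (E : Set Plane) : LipschitzEquivalent E E :=
  ⟨id, Function.bijective_id, 1, one_pos, fun x y => by simp⟩

theorem LipschitzEquivalent.symm {E F : Set Plane} (h : LipschitzEquivalent E F) :
    LipschitzEquivalent F E := by
  obtain ⟨g, hg, C, hC, h⟩ := h
  let e := Equiv.ofBijective g hg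
  refine ⟨e.symm, e.symm.bijective, C, hC, fun x y => ?_⟩
  have key := h (e.symm x) (e.symm y)
  have hx : g (e.symm x) = x := e.apply_symm_apply x
  have hy : g (e.symm y) = y := e.apply_symm_apply y
  rw [hx, hy] at key
  exact ⟨(inv_mul_le_iff₀ hC).2 key.2, (inv_mul_le_iff₀ hC).1 key.1⟩

theorem LipschitzEquivalent.trans {E F G : Set Plane} (h₁ : LipschitzEquivalent E F)
    (h₂ : LipschitzEquivalent F G) : LipschitzEquivalent E G := by
  obtain ⟨g, hg, C, hC, h⟩ := h₁
  obtain ⟨k, hk, K, hK, h'⟩ := h₂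
  refine ⟨k ∘ g, hk.comp hg, K * C, mul_pos hK hC, fun x y => ⟨?_, ?_⟩⟩
  · rw [mul_inv, mul_assoc]
    exact (mul_le_mul_of_nonneg_left (h x y).1 (inv_nonneg.2 hK.le)).trans (h' (g x) (g y)).1
  · rw [mul_assoc]
    exact (h' (g x) (g y)).2.trans (mul_le_mul_of_nonneg_left (h x y).2 hK.le)

/-- Lipschitz equivalence as an equivalence relation on a collection `𝓐` of subsets of the
plane. -/
def lipschitzSetoid (𝓐 : Set (Set Plane)) : Setoid 𝓐 where
  r E F := LipschitzEquivalent (E : Set Plane) (F : Set Plane)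
  iseqv :=
    { refl := fun E => LipschitzEquivalent.refl (E : Set Plane)
      symm := fun h => LipschitzEquivalent.symm h
      trans := fun h₁ h₂ => LipschitzEquivalent.trans h₁ h₂ }

/-- The number `#(𝓐 / ≃)` of Lipschitz equivalence classes in `𝓐`, infinite if there are
infinitely many. -/
noncomputable def numLipschitzClasses (𝓐 : Set (Set Plane)) : ℕ∞ :=
  ENat.card (Quotient (lipschitzSetoid 𝓐))

/-!
A fractal square is coded by the sequences of its digits: it is the set `range (expand v)` of all
points `∑ 3⁻ᵏ⁻¹ v (b k)`, where `v` lists the digits. A bijective affine map between digit sets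
induces one between the attractors (`lipschitzEquivalent_of_affine`), so the digit sets in `{0, 1,
2}²` have to be considered only up to affine equivalence. There are 1, 2, 7 and 13 affine classes
for two, three, four and five digits, and a finite search (`hasPlacement_two`, …,
`hasPlacement_five`) places a representative of one of them onto each digit set. It remains to
identify some of these classes, and, for three and four digits, to tell two of them apart.

*Dust-like attractors.* An attractor with `m` digits is `IsDust` when it is bi-Lipschitz to the
boundary of the `m`-ary tree with `3⁻ᵏ` as the distance of two sequences that split at index `k`;
any two such sets are equivalent. If different cells have positive distance, then the digit coding
shows that the attractor is dust-like (`isDust_of_separated`). In the other dust-like cases, cells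
may touch, but they form bounded clusters of finitely many shapes. A cluster of `w` cells is matched
with `w` sibling cylinders of the tree, its slots. Magnified by `3`, it falls apart into clusters
with `m * w` cells altogether, and these are distributed among the slots so that each slot gets
clusters with `m` cells. This is a finite automaton (`Coding`), and `Coding.isDust` reduces the
claim to a finite check of its transitions. The test `separated` certifies that two cells have
positive distance. By contrast, an attractor with three equidistant collinear digits contains a
segment, and every path in a dust-like set is constant (`IsDust.path_eq`), which yields the lower
bounds `2`.

*Segments with two cells beside them.* For five digits, three of the classes are dust-like and so
coincide, and one more coincidence is needed to come down to ten: a segment with two adjacent cells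
on one side is equivalent to a segment with two cells on opposite sides
(`lipschitzEquivalent_same_side_opposite_sides`). The latter digit set has the same neighbour graph
as `wideDigits`, whose two cells are on one side but do not touch, and codings with isomorphic
neighbour graphs are equivalent (`lipschitzEquivalent_of_neighbours`). Both sets are then a segment
with small pieces hanging on it at all triadic scales, and the pieces may be replaced by equivalent
ones (`IsComb.lipschitzEquivalent`). For the adjacent cells, a piece is the union of two adjacent
copies of the whole attractor, which is the attractor of `wideDigits` up to stretching. For
`wideDigits`, a piece consists of two disjoint copies of the attractor, and the second copy is
absorbed into the first along a sequence of shrinking copies in it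
(`lipschitzEquivalent_union_translate`).
-/

open Set Filter Topology

/-! ### Expansions in base `3` -/

/-- The point of the plane with integer coordinates `z`. -/
noncomputable def vec (z : ℤ × ℤ) : Plane := !₂[(z.1 : ℝ), (z.2 : ℝ)]

theorem vec_apply_zero (z : ℤ × ℤ) : vec z 0 = z.1 := rfl

theorem vec_apply_one (z : ℤ × ℤ) : vec z 1 = z.2 := rfl

theorem plane_ext {x y : Plane} (h₀ : x 0 = y 0) (h₁ : x 1 = y 1) : x = y := by
  ext i
  fin_cases i
  · exact h₀
  · exact h₁

theorem vec_zero : vec 0 = 0 := plane_ext (by simp [vec_apply_zero]) (by simp [vec_apply_one])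

theorem vec_add (z w : ℤ × ℤ) : vec (z + w) = vec z + vec w :=
  plane_ext (by simp [vec_apply_zero]) (by simp [vec_apply_one])

theorem vec_sub (z w : ℤ × ℤ) : vec (z - w) = vec z - vec w :=
  plane_ext (by simp [vec_apply_zero]) (by simp [vec_apply_one])

theorem vec_three_smul (z : ℤ × ℤ) : vec ((3 : ℤ) • z) = (3 : ℝ) • vec z :=
  plane_ext (by simp [vec_apply_zero]) (by simp [vec_apply_one])

theorem abs_apply_le_norm (x : Plane) (i : Fin 2) : |x i| ≤ ‖x‖ := by
  simpa using PiLp.norm_apply_le x i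

theorem norm_le_abs_add_abs (x : Plane) : ‖x‖ ≤ |x 0| + |x 1| := by
  rw [EuclideanSpace.norm_eq, Fin.sum_univ_two]
  apply Real.sqrt_le_iff.2
  refine ⟨by positivity, ?_⟩
  simp only [Real.norm_eq_abs]
  nlinarith [abs_nonneg (x 0), abs_nonneg (x 1)]

/-- A real number bounded by `y` up to every error `K / 3 ^ n` is bounded by `y`. -/
theorem le_of_forall_le_add_div_pow {x y K : ℝ} (h : ∀ n : ℕ, x ≤ y + K / 3 ^ n) : x ≤ y := by
  have hlim : Tendsto (fun n : ℕ => y + K * (1 / 3 : ℝ) ^ n) atTop (𝓝 (y + K * 0)) :=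
    ((tendsto_pow_atTop_nhds_zero_of_lt_one (by norm_num) (by norm_num)).const_mul K).const_add y
  rw [mul_zero, add_zero] at hlim
  refine ge_of_tendsto' hlim fun n => (h n).trans_eq ?_
  rw [one_div, inv_pow, div_eq_mul_inv]

/-- The point `∑ 3⁻ᵏ⁻¹ w (b k)` with base-`3` digits `w (b 0), w (b 1), …`. The digits are
read through a labelling `w` of a finite alphabet `κ`. -/
noncomputable def expand {κ : Type*} (w : κ → ℤ × ℤ) (b : ℕ → κ) : Plane :=
  ∑' k, ((3 : ℝ)⁻¹) ^ (k + 1) • vec (w (b k))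

/-- The sequence without its first term. -/
def seqTail {κ : Type*} (b : ℕ → κ) : ℕ → κ := fun k => b (k + 1)

/-- The sequence with a new first term. -/
def seqCons {κ : Type*} (i : κ) (b : ℕ → κ) : ℕ → κ
  | 0 => i
  | k + 1 => b k

theorem seqTail_seqCons {κ : Type*} (i : κ) (b : ℕ → κ) : seqTail (seqCons i b) = b := rfl

theorem summable_pow_three_inv (K : ℝ) : Summable fun k : ℕ => ((3 : ℝ)⁻¹) ^ (k + 1) * K :=
  ((summable_nat_add_iff 1).2
    (summable_geometric_of_lt_one (by norm_num) (by norm_num : (3 : ℝ)⁻¹ < 1))).mul_right K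

theorem norm_digit_term_le {κ : Type*} (w : κ → ℤ × ℤ) {K : ℝ} (hK : ∀ i, ‖vec (w i)‖ ≤ K)
    (b : ℕ → κ) (k : ℕ) :
    ‖((3 : ℝ)⁻¹) ^ (k + 1) • vec (w (b k))‖ ≤ ((3 : ℝ)⁻¹) ^ (k + 1) * K := by
  rw [norm_smul, norm_pow, norm_inv, Real.norm_ofNat]
  exact mul_le_mul_of_nonneg_left (hK _) (by positivity)

/-- Sequences over a discrete alphabet that are close to a given one agree with it up to a given
index. -/
theorem eventually_agree {κ : Type*} [TopologicalSpace κ] [DiscreteTopology κ] (a : ℕ → κ)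
    (k : ℕ) :
    ∀ᶠ b in 𝓝 a, ∀ i ≤ k, b i = a i := by
  have h : ∀ᶠ b in 𝓝 a, ∀ i ∈ Finset.range (k + 1), b i = a i := by
    rw [Filter.eventually_all_finset]
    intro i _
    have hi : Continuous fun b : ℕ → κ => b i := continuous_apply i
    exact (hi.tendsto a).eventually (p := fun y => y = a i)
      ((isOpen_discrete {a i}).mem_nhds rfl)
  exact h.mono fun b hb i hi => hb i (Finset.mem_range.2 (Nat.lt_succ_of_le hi))

section

variable {κ : Type*} [Finite κ] (w : κ → ℤ × ℤ)

theorem exists_norm_vec_le : ∃ K, 0 ≤ K ∧ ∀ i, ‖vec (w i)‖ ≤ K := by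
  obtain ⟨K, hK⟩ := (Set.finite_range fun i => ‖vec (w i)‖).bddAbove
  exact ⟨max K 0, le_max_right _ _, fun i => (hK ⟨i, rfl⟩).trans (le_max_left _ _)⟩

theorem summable_expand (b : ℕ → κ) :
    Summable fun k => ((3 : ℝ)⁻¹) ^ (k + 1) • vec (w (b k)) := by
  obtain ⟨K, -, hK⟩ := exists_norm_vec_le w
  exact .of_norm_bounded (summable_pow_three_inv K) (norm_digit_term_le w hK b)

theorem expand_eq (b : ℕ → κ) :
    expand w b = (3 : ℝ)⁻¹ • (expand w (seqTail b) + vec (w (b 0))) := by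
  rw [expand, (summable_expand w b).tsum_eq_zero_add, expand, smul_add,
    ← (summable_expand w (seqTail b)).tsum_const_smul, add_comm]
  congr 1
  · refine tsum_congr fun k => ?_
    rw [pow_succ' _ (k + 1), mul_smul]
    rfl
  · simp

theorem expand_seqCons (i : κ) (b : ℕ → κ) :
    expand w (seqCons i b) = (3 : ℝ)⁻¹ • (expand w b + vec (w i)) := by
  rw [expand_eq, seqTail_seqCons]
  rfl

theorem exists_norm_expand_le : ∃ K, 0 ≤ K ∧ ∀ b : ℕ → κ, ‖expand w b‖ ≤ K := by
  obtain ⟨K, hK0, hK⟩ := exists_norm_vec_le w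
  refine ⟨∑' k : ℕ, ((3 : ℝ)⁻¹) ^ (k + 1) * K, tsum_nonneg fun k => by positivity, fun b => ?_⟩
  exact tsum_of_norm_bounded (summable_pow_three_inv K).hasSum (norm_digit_term_le w hK b)

/-- Two expansions have coordinates at distance at most half the width of the digit set. -/
theorem abs_expand_sub_le {W : ℝ} {i : Fin 2} (hW : ∀ k l, |vec (w k) i - vec (w l) i| ≤ W)
    (a b : ℕ → κ) : |expand w a i - expand w b i| ≤ W / 2 := by
  obtain ⟨K, hK0, hK⟩ := exists_norm_expand_le w
  refine le_of_forall_le_add_div_pow (K := 2 * K) fun n => ?_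
  have hW0 : 0 ≤ W := (abs_nonneg _).trans (hW (a 0) (a 0))
  induction n generalizing a b with
  | zero =>
    have h1 := (abs_apply_le_norm (expand w a) i).trans (hK a)
    have h2 := (abs_apply_le_norm (expand w b) i).trans (hK b)
    have h3 := abs_sub (expand w a i) (expand w b i)
    rw [pow_zero, div_one]
    linarith
  | succ n ih =>
    rw [expand_eq w a, expand_eq w b]
    simp only [PiLp.smul_apply, PiLp.add_apply, smul_eq_mul]
    have h1 := abs_le.1 (ih (seqTail a) (seqTail b))
    have h2 := abs_le.1 (hW (a 0) (b 0))
    have h3 : 2 * K / 3 ^ (n + 1) = 2 * K / 3 ^ n / 3 := by rw [pow_succ, div_div]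
    rw [h3, abs_le]
    constructor <;> linarith [h1.1, h1.2, h2.1, h2.2]

/-- The expansions whose digits depend locally constantly on a parameter in a compact space form
a compact set. -/
theorem isCompact_range_expand_comp {Ω : Type*} [TopologicalSpace Ω] [CompactSpace Ω]
    {f : Ω → ℕ → κ} (hf : ∀ k, IsLocallyConstant fun a => f a k) :
    IsCompact (range fun a => expand w (f a)) := by
  obtain ⟨K, -, hK⟩ := exists_norm_vec_le w
  refine isCompact_range (continuous_tsum (f := fun k a => ((3 : ℝ)⁻¹) ^ (k + 1) • vec (w (f a k)))
    (fun k => ?_) (summable_pow_three_inv K) fun k a => norm_digit_term_le w hK (f a) k)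
  have h : Continuous fun a => vec (w (f a k)) := ((hf k).comp fun i => vec (w i)).continuous
  exact h.const_smul (((3 : ℝ)⁻¹) ^ (k + 1))

theorem isCompact_range_expand : IsCompact (range (expand w)) := by
  let _ : TopologicalSpace κ := ⊥
  have : DiscreteTopology κ := ⟨rfl⟩
  exact isCompact_range_expand_comp w (f := fun b => b) fun k =>
    (IsLocallyConstant.iff_eventually_eq _).2 fun a =>
      (eventually_agree a k).mono fun b hb => hb k le_rfl

end

/-! ### Comparing attractors -/

/-- Suppose that each point of each `X t` is `(x' + o) / 3` for a point `x'` of some `X t'`,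
and that `(y + o) / 3` lies in `Y t` for all `y` in `Y t'`. If the points of `X t` are within a
bounded distance of `Y t` and the `Y t` are closed, then `X t ⊆ Y t` : refining the
approximation divides the distance by `3`. -/
theorem subset_of_refinement {τ : Type*} {X Y : τ → Set Plane} {K : ℝ}
    (hK : ∀ t, ∀ x ∈ X t, ∃ y ∈ Y t, dist x y ≤ K)
    (hclosed : ∀ t, IsClosed (Y t))
    (hstep : ∀ t, ∀ x ∈ X t, ∃ t', ∃ x' ∈ X t', ∃ o : Plane, x = (3 : ℝ)⁻¹ • (x' + o) ∧
      ∀ y ∈ Y t', (3 : ℝ)⁻¹ • (y + o) ∈ Y t) (t : τ) : X t ⊆ Y t := by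
  have key : ∀ n : ℕ, ∀ t, ∀ x ∈ X t, ∃ y ∈ Y t, dist x y ≤ K / 3 ^ n := by
    intro n
    induction n with
    | zero => simpa using hK
    | succ n ih =>
      intro t x hx
      obtain ⟨t', x', hx', o, rfl, ho⟩ := hstep t x hx
      obtain ⟨y, hy, hxy⟩ := ih t' x' hx'
      refine ⟨_, ho y hy, ?_⟩
      rw [dist_smul₀, dist_add_right, norm_inv, Real.norm_ofNat, pow_succ, ← div_div,
        inv_mul_eq_div]
      gcongr
  intro x hx
  obtain ⟨y₀, hy₀, -⟩ := hK t x hx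
  rw [← (hclosed t).closure_eq, Metric.mem_closure_iff_infDist_zero ⟨y₀, hy₀⟩]
  refine le_antisymm (le_of_forall_le_add_div_pow (K := K) fun n => ?_) Metric.infDist_nonneg
  obtain ⟨y, hy, hxy⟩ := key n t x hx
  rw [zero_add]
  exact (Metric.infDist_le_dist_of_mem hy).trans hxy

theorem IsSelfSimilarSet.eq_range_expand {κ : Type*} [Finite κ] {D : Finset (ℕ × ℕ)}
    {F : Set Plane} (hF : IsSelfSimilarSet 3 D F) {v : κ → ℤ × ℤ}
    (hv : ∀ z : ℤ × ℤ, z ∈ range v ↔ ∃ d ∈ D, ((d.1 : ℤ), (d.2 : ℤ)) = z) :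
    F = range (expand v) := by
  obtain ⟨⟨x₀, hx₀⟩, hc, heq⟩ := hF
  have hdig : ∀ d : ℕ × ℕ, ∀ x, digitMap 3 d x = (3 : ℝ)⁻¹ • (x + vec ((d.1 : ℤ), (d.2 : ℤ))) :=
    fun d x => by simp [digitMap, vec]
  have hne : Nonempty κ := by
    rw [heq] at hx₀
    simp only [mem_iUnion] at hx₀
    obtain ⟨d, hd, -⟩ := hx₀
    obtain ⟨i, -⟩ := (hv _).2 ⟨d, hd, rfl⟩
    exact ⟨i⟩
  obtain ⟨R, hR⟩ := hc.isBounded.exists_norm_le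
  obtain ⟨K, hK0, hK⟩ := exists_norm_expand_le v
  have hdist : ∀ x ∈ F, ∀ b, dist x (expand v b) ≤ R + K := fun x hx b =>
    (dist_le_norm_add_norm _ _).trans (add_le_add (hR x hx) (hK b))
  refine Subset.antisymm ?_ ?_
  · refine subset_of_refinement (τ := Unit) (X := fun _ => F) (Y := fun _ => range (expand v))
      (K := R + K) (fun _ x hx => ?_) (fun _ => (isCompact_range_expand v).isClosed)
      (fun _ x hx => ?_) ()
    · obtain ⟨i⟩ := hne
      exact ⟨_, ⟨fun _ => i, rfl⟩, hdist x hx _⟩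
    · rw [heq] at hx
      simp only [mem_iUnion] at hx
      obtain ⟨d, hd, x', hx', rfl⟩ := hx
      obtain ⟨i, hi⟩ := (hv _).2 ⟨d, hd, rfl⟩
      refine ⟨(), x', hx', _, hdig d x', ?_⟩
      rintro _ ⟨b, rfl⟩
      exact ⟨seqCons i b, by rw [expand_seqCons, hi]⟩
  · refine subset_of_refinement (τ := Unit) (X := fun _ => range (expand v)) (Y := fun _ => F)
      (K := R + K) (fun _ x hx => ?_) (fun _ => hc.isClosed) (fun _ x hx => ?_) ()
    · obtain ⟨b, rfl⟩ := hx
      exact ⟨x₀, hx₀, by rw [dist_comm]; exact hdist _ hx₀ b⟩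
    · obtain ⟨b, rfl⟩ := hx
      refine ⟨(), _, ⟨seqTail b, rfl⟩, _, expand_eq v b, fun y hy => ?_⟩
      obtain ⟨d, hd, hdb⟩ := (hv _).1 ⟨b 0, rfl⟩
      rw [heq, ← hdb, ← hdig]
      exact mem_biUnion hd ⟨y, hy, rfl⟩

theorem isSelfSimilarSet_range_expand {κ : Type*} [Finite κ] [Nonempty κ] {D : Finset (ℕ × ℕ)}
    {v : κ → ℤ × ℤ} (hv : ∀ z : ℤ × ℤ, z ∈ range v ↔ ∃ d ∈ D, ((d.1 : ℤ), (d.2 : ℤ)) = z) :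
    IsSelfSimilarSet 3 D (range (expand v)) := by
  have hdig : ∀ d : ℕ × ℕ, ∀ x, digitMap 3 d x = (3 : ℝ)⁻¹ • (x + vec ((d.1 : ℤ), (d.2 : ℤ))) :=
    fun d x => by simp [digitMap, vec]
  refine ⟨range_nonempty _, isCompact_range_expand v, Subset.antisymm ?_ ?_⟩
  · rintro _ ⟨b, rfl⟩
    obtain ⟨d, hd, hdb⟩ := (hv _).1 ⟨b 0, rfl⟩
    exact mem_biUnion hd ⟨_, ⟨seqTail b, rfl⟩, by rw [hdig, hdb, expand_eq v b]⟩
  · refine iUnion₂_subset fun d hd => ?_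
    rintro _ ⟨_, ⟨b, rfl⟩, rfl⟩
    obtain ⟨i, hi⟩ := (hv _).2 ⟨d, hd, rfl⟩
    exact ⟨seqCons i b, by rw [expand_seqCons, hi, hdig]⟩

/-! ### Comparable parametrizations -/

/-- Two maps into the plane are comparable when they distort each other's distances by a
bounded factor. -/
def Comparable {Ω : Type*} (φ ψ : Ω → Plane) : Prop :=
  ∃ C : ℝ, 0 < C ∧ ∀ a b, dist (φ a) (φ b) ≤ C * dist (ψ a) (ψ b) ∧
    dist (ψ a) (ψ b) ≤ C * dist (φ a) (φ b)

theorem Comparable.of_le {Ω : Type*} {φ ψ : Ω → Plane} (C₁ C₂ : ℝ)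
    (h₁ : ∀ a b, dist (φ a) (φ b) ≤ C₁ * dist (ψ a) (ψ b))
    (h₂ : ∀ a b, dist (ψ a) (ψ b) ≤ C₂ * dist (φ a) (φ b)) : Comparable φ ψ := by
  refine ⟨max (max C₁ C₂) 1, by positivity, fun a b => ⟨(h₁ a b).trans ?_, (h₂ a b).trans ?_⟩⟩
  · exact mul_le_mul_of_nonneg_right ((le_max_left _ _).trans (le_max_left _ _)) dist_nonneg
  · exact mul_le_mul_of_nonneg_right ((le_max_right _ _).trans (le_max_left _ _)) dist_nonneg

theorem Comparable.lipschitzEquivalent {Ω : Type*} {φ ψ : Ω → Plane} (h : Comparable φ ψ) :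
    LipschitzEquivalent (range φ) (range ψ) := by
  obtain ⟨C, hC, h⟩ := h
  choose s hs using fun x : range φ => x.2
  have eq_iff : ∀ a b, φ a = φ b ↔ ψ a = ψ b := fun a b => by
    constructor <;> intro hab
    · have := (h a b).2
      rw [hab, dist_self, mul_zero] at this
      exact dist_le_zero.1 this
    · have := (h a b).1
      rw [hab, dist_self, mul_zero] at this
      exact dist_le_zero.1 this
  refine ⟨fun x => ⟨ψ (s x), s x, rfl⟩, ⟨fun x y hxy => ?_, ?_⟩, C, hC, fun x y => ?_⟩
  · have hxy' := (eq_iff _ _).2 (congrArg Subtype.val hxy)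
    rw [hs, hs] at hxy'
    exact Subtype.ext hxy'
  · rintro ⟨_, a, rfl⟩
    exact ⟨⟨φ a, a, rfl⟩, Subtype.ext ((eq_iff _ _).1 (hs ⟨φ a, a, rfl⟩))⟩
  · have hxy := h (s x) (s y)
    rw [hs, hs] at hxy
    exact ⟨(inv_mul_le_iff₀ hC).2 hxy.1, hxy.2⟩

theorem LipschitzEquivalent.exists_comparable {E F : Set Plane} (h : LipschitzEquivalent E F) :
    ∃ ψ : E → Plane, range ψ = F ∧ Comparable Subtype.val ψ := by
  obtain ⟨g, hg, C, hC, h⟩ := h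
  refine ⟨fun x => g x, ?_, C, hC, fun x y => ⟨?_, (h x y).2⟩⟩
  · rw [show (fun x => (g x : Plane)) = Subtype.val ∘ g from rfl, range_comp,
      hg.2.range_eq, image_univ, Subtype.range_coe]
  · exact (inv_mul_le_iff₀ hC).1 (h x y).1

/-- An affine bijection of the plane carrying the digits of `v` to those of `v'` carries the
attractor of `v` to that of `v'`. -/
theorem lipschitzEquivalent_of_affine {κ : Type*} [Finite κ] {v v' : κ → ℤ × ℤ}
    (p a b : ℤ × ℤ) (hdet : a.1 * b.2 - a.2 * b.1 ≠ 0)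
    (h : ∀ i, v' i = p + (v i).1 • a + (v i).2 • b) :
    LipschitzEquivalent (range (expand v)) (range (expand v')) := by
  let L : Plane →ₗ[ℝ] Plane :=
    { toFun := fun x => x 0 • vec a + x 1 • vec b
      map_add' := fun x y => by simp only [PiLp.add_apply, add_smul]; abel
      map_smul' := fun c x => by
        simp only [PiLp.smul_apply, smul_eq_mul, mul_smul, smul_add, RingHom.id_apply] }
  have hL : ∀ x, L x = x 0 • vec a + x 1 • vec b := fun _ => rfl
  have hker : LinearMap.ker L = ⊥ := by
    rw [LinearMap.ker_eq_bot']
    intro x hx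
    have h0 := congrArg (fun y : Plane => y 0) hx
    have h1 := congrArg (fun y : Plane => y 1) hx
    simp only [hL, PiLp.add_apply, PiLp.smul_apply, smul_eq_mul, vec_apply_zero, vec_apply_one,
      PiLp.zero_apply] at h0 h1
    have hd : ((a.1 : ℝ) * b.2 - a.2 * b.1) ≠ 0 := by exact_mod_cast hdet
    refine plane_ext ?_ ?_ <;> apply mul_left_cancel₀ hd <;> rw [PiLp.zero_apply, mul_zero]
    · linear_combination (b.2 : ℝ) * h0 - (b.1 : ℝ) * h1
    · linear_combination (a.1 : ℝ) * h1 - (a.2 : ℝ) * h0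
  have hexp : ∀ c, expand v' c = (2 : ℝ)⁻¹ • vec p + L (expand v c) := by
    -- Both sides satisfy the same contracting recursion, so that they agree.
    obtain ⟨K, hK0, hK⟩ := exists_norm_expand_le v'
    obtain ⟨K', hK0', hK'⟩ := exists_norm_expand_le v
    let T := LinearMap.toContinuousLinearMap L
    have hT : ∀ c, ‖(2 : ℝ)⁻¹ • vec p + L (expand v c)‖ ≤ ‖(2 : ℝ)⁻¹ • vec p‖ + ‖T‖ * K' :=
      fun c => (norm_add_le _ _).trans (add_le_add_right ((T.le_opNorm _).trans
        (mul_le_mul_of_nonneg_left (hK' c) (norm_nonneg _))) _)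
    intro c
    refine dist_le_zero.1 (le_of_forall_le_add_div_pow
      (K := K + (‖(2 : ℝ)⁻¹ • vec p‖ + ‖T‖ * K')) fun n => ?_)
    rw [zero_add]
    induction n generalizing c with
    | zero =>
      rw [pow_zero, div_one]
      exact (dist_le_norm_add_norm _ _).trans (add_le_add (hK c) (hT c))
    | succ n ih =>
      have e : (2 : ℝ)⁻¹ • vec p + L (expand v c) =
          (3 : ℝ)⁻¹ • (((2 : ℝ)⁻¹ • vec p + L (expand v (seqTail c))) + vec (v' (c 0))) := by
        rw [expand_eq v c, h]
        refine plane_ext ?_ ?_ <;>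
        · simp [hL, vec_add, vec_apply_zero, vec_apply_one]
          ring
      rw [e, expand_eq v' c, dist_smul₀, dist_add_right, norm_inv, Real.norm_ofNat, pow_succ,
        ← div_div, inv_mul_eq_div]
      exact div_le_div_of_nonneg_right (ih _) (by norm_num)
  obtain ⟨K, -, hK⟩ := L.exists_antilipschitzWith hker
  refine (Comparable.of_le K ‖LinearMap.toContinuousLinearMap L‖ (fun c d => ?_)
    fun c d => ?_).lipschitzEquivalent
  · rw [hexp, hexp, dist_add_left]
    exact hK.le_mul_dist _ _
  · rw [hexp, hexp, dist_add_left]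
    exact (LinearMap.toContinuousLinearMap L).lipschitz.dist_le_mul _ _

/-! ### Separated translates of an attractor -/

/-- Both coordinates of the differences of the digits of `v` are at most `W` in absolute value. -/
def HasWidth {m : ℕ} (v : Fin m → ℤ × ℤ) (W : ℕ) : Prop :=
  ∀ i j, ((v i).1 - (v j).1).natAbs ≤ W ∧ ((v i).2 - (v j).2).natAbs ≤ W

instance {m : ℕ} (v : Fin m → ℤ × ℤ) (W : ℕ) : Decidable (HasWidth v W) := by
  delta HasWidth
  infer_instance

/-- A test for the translates by `0` and `δ` of the attractor of a digit set `v` of width `W` to be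
disjoint: refining both sets at most `n` times, one sees only pairs of pieces whose bounding
boxes are apart. -/
def separated {m : ℕ} (v : Fin m → ℤ × ℤ) (W : ℕ) : ℕ → ℤ × ℤ → Bool
  | 0, δ => decide (W + 2 ≤ 2 * δ.1.natAbs ∨ W + 2 ≤ 2 * δ.2.natAbs)
  | n + 1, δ => decide (W + 2 ≤ 2 * δ.1.natAbs ∨ W + 2 ≤ 2 * δ.2.natAbs) ||
      decide (∀ i j, separated v W n
        (3 * δ.1 + ((v i).1 - (v j).1), 3 * δ.2 + ((v i).2 - (v j).2)) = true)

theorem int_abs_sub_le {W : ℕ} {x y : ℤ} (h : (x - y).natAbs ≤ W) : |(x : ℝ) - y| ≤ W := by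
  rw [← Int.cast_sub, ← Int.cast_abs, Int.abs_eq_natAbs, Int.cast_natCast]
  exact_mod_cast h

theorem one_le_dist_of_far {m W : ℕ} {v : Fin m → ℤ × ℤ} (hW : HasWidth v W) {δ : ℤ × ℤ}
    (h : W + 2 ≤ 2 * δ.1.natAbs ∨ W + 2 ≤ 2 * δ.2.natAbs) (a b : ℕ → Fin m) :
    1 ≤ dist (expand v a + vec δ) (expand v b) := by
  have key : ∀ i : Fin 2, ∀ x : ℤ, vec δ i = x → (∀ k l, |vec (v k) i - vec (v l) i| ≤ W) →
      W + 2 ≤ 2 * x.natAbs → 1 ≤ dist (expand v a + vec δ) (expand v b) := by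
    intro i x hx hv hle
    have h1 := abs_expand_sub_le v hv a b
    have h2 := abs_apply_le_norm (expand v a + vec δ - expand v b) i
    rw [PiLp.sub_apply, PiLp.add_apply, hx] at h2
    have h3 : (W : ℝ) + 2 ≤ 2 * |(x : ℝ)| := by
      rw [← Int.cast_abs, Int.abs_eq_natAbs, Int.cast_natCast]
      exact_mod_cast hle
    have h4 : |(x : ℝ)| ≤
        |expand v a i + x - expand v b i| + |expand v a i - expand v b i| := by
      have := abs_sub (expand v a i + x - expand v b i) (expand v a i - expand v b i)
      rwa [show expand v a i + x - expand v b i - (expand v a i - expand v b i) = (x : ℝ) by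
        ring] at this
    rw [dist_eq_norm]
    linarith
  rcases h with h | h
  · exact key 0 δ.1 rfl (fun k l => int_abs_sub_le (hW k l).1) h
  · exact key 1 δ.2 rfl (fun k l => int_abs_sub_le (hW k l).2) h

theorem expand_add_sub_expand {κ : Type*} [Finite κ] (v : κ → ℤ × ℤ) (δ : ℤ × ℤ)
    (a b : ℕ → κ) :
    dist (expand v a + vec δ) (expand v b) = (3 : ℝ)⁻¹ *
      dist (expand v (seqTail a) + vec ((3 : ℤ) • δ + (v (a 0) - v (b 0))))
        (expand v (seqTail b)) := by
  rw [expand_eq v a, expand_eq v b, dist_eq_norm, dist_eq_norm,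
    show ((3 : ℝ)⁻¹) = ‖(3 : ℝ)⁻¹‖ by rw [norm_inv, Real.norm_ofNat], ← norm_smul, norm_inv,
    Real.norm_ofNat]
  congr 1
  rw [vec_add, vec_three_smul, vec_sub]
  module

theorem le_dist_of_separated {m W : ℕ} {v : Fin m → ℤ × ℤ} (hW : HasWidth v W) {n : ℕ}
    {δ : ℤ × ℤ} (h : separated v W n δ = true) (a b : ℕ → Fin m) :
    ((3 : ℝ) ^ n)⁻¹ ≤ dist (expand v a + vec δ) (expand v b) := by
  induction n generalizing δ a b with
  | zero => simpa using one_le_dist_of_far hW (of_decide_eq_true h) a b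
  | succ n ih =>
    rcases Bool.or_eq_true_iff.1 h with h | h
    · refine le_trans ?_ (one_le_dist_of_far hW (of_decide_eq_true h) a b)
      exact inv_le_one_of_one_le₀ (one_le_pow₀ (by norm_num))
    · rw [expand_add_sub_expand, pow_succ', mul_inv]
      exact mul_le_mul_of_nonneg_left (ih (of_decide_eq_true h (a 0) (b 0)) _ _) (by norm_num)

/-! ### Digit sets with isomorphic neighbour graphs -/

/-- One half of `lipschitzEquivalent_of_neighbours`. -/
theorem exists_dist_le_of_neighbours {m W n : ℕ} {v v' : Fin m → ℤ × ℤ}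
    (hW : HasWidth v' W) (N : Finset ((ℤ × ℤ) × (ℤ × ℤ)))
    (h : ∀ δ ∈ N, ∀ i j, ((3 : ℤ) • δ.1 + (v i - v j), (3 : ℤ) • δ.2 + (v' i - v' j)) ∈ N ∨
      separated v' W n ((3 : ℤ) • δ.2 + (v' i - v' j)) = true) :
    ∃ C, ∀ δ ∈ N, ∀ a b, dist (expand v a + vec δ.1) (expand v b) ≤
      C * dist (expand v' a + vec δ.2) (expand v' b) := by
  obtain ⟨K₀, hK₀, hK⟩ := exists_norm_expand_le v
  obtain ⟨B, hB⟩ := (N.finite_toSet.image fun δ => ‖vec δ.1‖).bddAbove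
  set K := K₀ + B + K₀
  have hbound : ∀ δ ∈ N, ∀ a b, dist (expand v a + vec δ.1) (expand v b) ≤ K := fun δ hδ a b =>
    (dist_le_norm_add_norm _ _).trans (add_le_add ((norm_add_le _ _).trans
      (add_le_add (hK a) (hB ⟨δ, hδ, rfl⟩))) (hK b))
  refine ⟨K * 3 ^ (n + 1), fun δ hδ a b => ?_⟩
  have hK0 : 0 ≤ K := dist_nonneg.trans (hbound δ hδ a b)
  refine le_of_forall_le_add_div_pow (K := K) fun k => ?_
  induction k generalizing δ a b with
  | zero =>
    rw [pow_zero, div_one]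
    exact (hbound δ hδ a b).trans (le_add_of_nonneg_left (by positivity))
  | succ k ih =>
    rcases h δ hδ (a 0) (b 0) with hmem | hsep
    · rw [expand_add_sub_expand v, expand_add_sub_expand v', pow_succ 3 k]
      have := ih _ hmem (seqTail a) (seqTail b)
      rw [← div_div]
      linarith
    · have h1 := le_dist_of_separated hW hsep (seqTail a) (seqTail b)
      have h2 : 1 ≤ 3 ^ (n + 1) * dist (expand v' a + vec δ.2) (expand v' b) := by
        rw [expand_add_sub_expand v', pow_succ, mul_assoc, mul_inv_cancel_left₀ (by norm_num)]
        rwa [inv_le_iff_one_le_mul₀' (by positivity)] at h1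
      have h3 : K ≤ K * (3 ^ (n + 1) * dist (expand v' a + vec δ.2) (expand v' b)) :=
        le_mul_of_one_le_right hK0 h2
      rw [mul_assoc]
      exact (hbound δ hδ a b).trans (h3.trans (le_add_of_nonneg_right (by positivity)))

/-- Let `N` be a matching between relative positions of neighbouring pieces of two attractors.
If refining a pair of neighbours always leads either to a pair of matched neighbours or to two
pairs of separated pieces, then the digitwise correspondence is bi-Lipschitz: the distance of two
points is, up to a bounded factor, `3⁻ᵏ` for the number `k` of refinements after which their
pieces cease to be neighbours. -/
theorem lipschitzEquivalent_of_neighbours {m W W' n : ℕ} {v v' : Fin m → ℤ × ℤ}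
    (hW : HasWidth v W) (hW' : HasWidth v' W') (N : Finset ((ℤ × ℤ) × (ℤ × ℤ))) (h0 : 0 ∈ N)
    (h : ∀ δ ∈ N, ∀ i j, ((3 : ℤ) • δ.1 + (v i - v j), (3 : ℤ) • δ.2 + (v' i - v' j)) ∈ N ∨
      (separated v W n ((3 : ℤ) • δ.1 + (v i - v j)) = true ∧
      separated v' W' n ((3 : ℤ) • δ.2 + (v' i - v' j)) = true)) :
    LipschitzEquivalent (range (expand v)) (range (expand v')) := by
  obtain ⟨C, hC⟩ := exists_dist_le_of_neighbours (v := v) hW' N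
    fun δ hδ i j => (h δ hδ i j).imp_right And.right
  obtain ⟨C', hC'⟩ := exists_dist_le_of_neighbours (v := v') hW (N.image Prod.swap)
    (n := n) (by
      intro δ hδ i j
      obtain ⟨ε, hε, rfl⟩ := Finset.mem_image.1 hδ
      exact (h ε hε i j).imp (fun h => Finset.mem_image.2 ⟨_, h, rfl⟩) And.left)
  refine (Comparable.of_le C C' (fun a b => ?_) fun a b => ?_).lipschitzEquivalent
  · simpa [vec_zero] using hC 0 h0 a b
  · simpa [vec_zero] using hC' 0 (Finset.mem_image.2 ⟨0, h0, rfl⟩) a b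

/-! ### Dust-like sets -/

/-- `F` is a bi-Lipschitz image of the space of sequences of `m` letters, in which sequences that
first differ at index `k` are at distance `3⁻ᵏ`. -/
def IsDust (m : ℕ) (F : Set Plane) : Prop :=
  ∃ φ : (ℕ → Fin m) → Plane, range φ = F ∧ ∃ C : ℝ, 0 < C ∧ ∀ k a b, (∀ i < k, a i = b i) →
    dist (φ a) (φ b) ≤ C * ((3 : ℝ) ^ k)⁻¹ ∧ (a k ≠ b k → ((3 : ℝ) ^ k)⁻¹ ≤ C * dist (φ a) (φ b))

theorem exists_first_ne {κ : Type*} {a b : ℕ → κ} (h : a ≠ b) :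
    ∃ k, (∀ i < k, a i = b i) ∧ a k ≠ b k := by
  classical
  have hne : ∃ k, a k ≠ b k := Function.ne_iff.1 h
  exact ⟨Nat.find hne, fun i hi => not_not.1 (Nat.find_min hne hi), Nat.find_spec hne⟩

theorem IsDust.lipschitzEquivalent {m : ℕ} {E F : Set Plane} (hE : IsDust m E)
    (hF : IsDust m F) : LipschitzEquivalent E F := by
  obtain ⟨φ, rfl, C, hC, hφ⟩ := hE
  obtain ⟨ψ, rfl, K, hK, hψ⟩ := hF
  refine (Comparable.of_le (C * K) (K * C) (fun a b => ?_) fun a b => ?_).lipschitzEquivalent <;>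
  · rcases eq_or_ne a b with rfl | hab
    · simp
    · obtain ⟨k, hk, hne⟩ := exists_first_ne hab
      rw [mul_assoc]
      first
        | exact (hφ k a b hk).1.trans (mul_le_mul_of_nonneg_left ((hψ k a b hk).2 hne) hC.le)
        | exact (hψ k a b hk).1.trans (mul_le_mul_of_nonneg_left ((hφ k a b hk).2 hne) hK.le)

theorem IsDust.of_lipschitzEquivalent {m : ℕ} {E F : Set Plane} (hE : IsDust m E)
    (h : LipschitzEquivalent E F) : IsDust m F := by
  obtain ⟨φ, rfl, C, hC, hφ⟩ := hE
  obtain ⟨ψ, rfl, K, hK, hψ⟩ := h.exists_comparable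
  refine ⟨fun a => ψ ⟨φ a, a, rfl⟩, ?_, C * K, by positivity, fun k a b hk => ⟨?_, fun hne => ?_⟩⟩
  · ext x
    constructor
    · rintro ⟨a, rfl⟩
      exact ⟨_, rfl⟩
    · rintro ⟨⟨_, a, rfl⟩, rfl⟩
      exact ⟨a, rfl⟩
  · refine (hψ _ _).2.trans ?_
    rw [mul_comm C, mul_assoc]
    exact mul_le_mul_of_nonneg_left (hφ k a b hk).1 hK.le
  · refine ((hφ k a b hk).2 hne).trans ?_
    rw [mul_assoc]
    exact mul_le_mul_of_nonneg_left (hψ ⟨φ a, a, rfl⟩ ⟨φ b, b, rfl⟩).1 hC.le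

/-- Dust-like sets contain no nonconstant path: along a path, each letter of the code is locally
constant. -/
theorem IsDust.path_eq {m : ℕ} {F : Set Plane} (hF : IsDust m F) {γ : unitInterval → Plane}
    (hγ : Continuous γ) (hmem : ∀ t, γ t ∈ F) (s t : unitInterval) : γ s = γ t := by
  obtain ⟨φ, rfl, C, hC, hφ⟩ := hF
  choose c hc using hmem
  have hloc : ∀ k, IsLocallyConstant fun t => c t k := fun k => by
    refine (IsLocallyConstant.iff_eventually_eq _).2 fun t => ?_
    have hpos : 0 < ((3 : ℝ) ^ k)⁻¹ / C := by positivity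
    filter_upwards [hγ.continuousAt.eventually (Metric.ball_mem_nhds (γ t) hpos)] with s hs
    by_contra hne
    obtain ⟨j, hj, hjne⟩ := exists_first_ne (a := c s) (b := c t) fun h => hne (congrFun h k)
    have hjk : j ≤ k := not_lt.1 fun hlt => hne (hj k hlt)
    have h1 := (hφ j _ _ hj).2 hjne
    rw [hc, hc] at h1
    have h2 : ((3 : ℝ) ^ k)⁻¹ ≤ ((3 : ℝ) ^ j)⁻¹ := by gcongr; norm_num
    rw [lt_div_iff₀ hC] at hs
    linarith
  rw [← hc s, ← hc t, funext fun k => (hloc k).apply_eq_of_preconnectedSpace s t]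

/-! ### Coding an attractor by an automaton -/

/-- A coding of finite unions of cells by sequences of `m` letters. A state `s` stands for one of
the slots of a cluster of cells, of the kind `kind s`; `shape` gives the positions of the cells of
a cluster of a given kind. Reading the letter `i` in state `s` leads to the slot `next s i` of a
smaller cluster, placed at `off s i` after magnification by `3`. -/
structure Coding (m : ℕ) (σ τ : Type) where
  kind : σ → τ
  shape : τ → Finset (ℤ × ℤ)
  next : σ → Fin m → σ
  off : σ → Fin m → ℤ × ℤ

namespace Coding

variable {m : ℕ} {σ τ : Type} (A : Coding m σ τ)

/-- The states visited, and the letters read, along a sequence of letters. -/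
def run (s : σ) (a : ℕ → Fin m) : ℕ → σ × Fin m
  | 0 => (s, a 0)
  | k + 1 => run (A.next s (a 0)) (seqTail a) k

/-- The point of the plane coded by a sequence of letters, read from the state `s`. -/
noncomputable def point (s : σ) (a : ℕ → Fin m) : Plane :=
  expand (fun p : σ × Fin m => A.off p.1 p.2) (A.run s a)

/-- The union of the translates of the attractor of `v` in a cluster of a given kind. -/
def cluster (v : Fin m → ℤ × ℤ) (t : τ) : Set Plane :=
  {x | ∃ p ∈ A.shape t, ∃ b, x = expand v b + vec p}

/-- The points coded by the slots of a cluster of a given kind. -/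
def points (t : τ) : Set Plane :=
  {x | ∃ s, A.kind s = t ∧ ∃ a, x = A.point s a}

/-- The smaller clusters are made of cells of the magnified cluster, and every cell of the
magnified cluster belongs to a smaller cluster all of whose slots are reached. -/
def Covers (v : Fin m → ℤ × ℤ) : Prop :=
  (∀ s i, ∀ c ∈ A.shape (A.kind (A.next s i)), ∃ p ∈ A.shape (A.kind s), ∃ j,
    A.off s i + c = (3 * p.1 + (v j).1, 3 * p.2 + (v j).2)) ∧
  ∀ t, ∀ p ∈ A.shape t, ∀ j, ∃ s i, A.kind s = t ∧
    (∃ c ∈ A.shape (A.kind (A.next s i)),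
      A.off s i + c = (3 * p.1 + (v j).1, 3 * p.2 + (v j).2)) ∧
    ∀ s', A.kind s' = A.kind (A.next s i) →
      ∃ s₂ i₂, A.kind s₂ = t ∧ A.next s₂ i₂ = s' ∧ A.off s₂ i₂ = A.off s i

/-- Two slots of a cluster, or two letters read in the same slot, lead to separated clusters, or
else the letters are read in the same slot and lead to different slots of the same cluster. -/
def Separates (v : Fin m → ℤ × ℤ) (W n : ℕ) : Prop :=
  ∀ s s', A.kind s = A.kind s' → ∀ i i', (s, i) ≠ (s', i') →
    (∀ p ∈ A.shape (A.kind (A.next s i)), ∀ p' ∈ A.shape (A.kind (A.next s' i')),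
      separated v W n (A.off s i + p - (A.off s' i' + p')) = true) ∨
    (s = s' ∧ A.off s i = A.off s' i' ∧ A.kind (A.next s i) = A.kind (A.next s' i') ∧
      A.next s i ≠ A.next s' i')

set_option synthInstance.maxSize 2000 in
set_option synthInstance.maxHeartbeats 200000 in
instance [Fintype σ] [Fintype τ] [DecidableEq σ] [DecidableEq τ] (v : Fin m → ℤ × ℤ) :
    Decidable (A.Covers v) := by
  delta Covers
  infer_instance

instance [Fintype σ] [DecidableEq σ] [DecidableEq τ] (v : Fin m → ℤ × ℤ) (W n : ℕ) :
    Decidable (A.Separates v W n) := by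
  delta Separates
  infer_instance

theorem run_eq (s : σ) (a : ℕ → Fin m) :
    A.run s a = seqCons (s, a 0) (A.run (A.next s (a 0)) (seqTail a)) := by
  funext k
  cases k <;> rfl

theorem run_congr {s : σ} {a b : ℕ → Fin m} {k : ℕ} (h : ∀ i ≤ k, a i = b i) :
    A.run s a k = A.run s b k := by
  induction k generalizing s a b with
  | zero => rw [run, run, h 0 le_rfl]
  | succ k ih =>
    rw [run, run, h 0 (Nat.zero_le _)]
    exact ih fun i hi => h (i + 1) (Nat.succ_le_succ hi)

theorem point_eq [Finite σ] (s : σ) (a : ℕ → Fin m) :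
    A.point s a =
      (3 : ℝ)⁻¹ • (A.point (A.next s (a 0)) (seqTail a) + vec (A.off s (a 0))) := by
  rw [point, run_eq, expand_seqCons]
  rfl

theorem isClosed_points [Finite σ] (t : τ) : IsClosed (A.points t) := by
  have h : A.points t = ⋃ s ∈ {s | A.kind s = t}, range (A.point s) := by
    ext x
    simp only [points, mem_ofPred_eq, mem_iUnion, mem_range, exists_prop, eq_comm (a := x)]
  rw [h]
  refine Set.Finite.isClosed_biUnion (toFinite _) fun s _ => IsCompact.isClosed ?_
  exact isCompact_range_expand_comp _ fun k => (IsLocallyConstant.iff_eventually_eq _).2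
    fun a => (eventually_agree a k).mono fun b hb => A.run_congr hb

theorem isClosed_cluster (v : Fin m → ℤ × ℤ) (t : τ) : IsClosed (A.cluster v t) := by
  have h : A.cluster v t = ⋃ p ∈ A.shape t, (fun x => x + vec p) '' range (expand v) := by
    ext x
    simp only [cluster, mem_ofPred_eq, mem_iUnion, mem_image, mem_range, exists_prop,
      exists_exists_eq_and, eq_comm (a := x)]
  rw [h]
  refine Set.Finite.isClosed_biUnion (A.shape t).finite_toSet fun p _ => IsCompact.isClosed ?_
  exact (isCompact_range_expand v).image (continuous_id.add continuous_const)

variable {A} {v : Fin m → ℤ × ℤ}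

theorem exists_dist_le [Finite σ] [Finite τ] :
    ∃ K, ∀ t, ∀ x ∈ A.cluster v t, ∀ y ∈ A.points t, dist x y ≤ K := by
  obtain ⟨K₁, -, h₁⟩ := exists_norm_expand_le v
  obtain ⟨K₂, -, h₂⟩ := exists_norm_expand_le fun p : σ × Fin m => A.off p.1 p.2
  obtain ⟨B, hB⟩ : BddAbove (⋃ t, (fun p => ‖vec p‖) '' (A.shape t : Set (ℤ × ℤ))) :=
    (Set.finite_iUnion fun t => (A.shape t).finite_toSet.image _).bddAbove
  refine ⟨K₁ + B + K₂, ?_⟩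
  rintro t _ ⟨p, hp, b, rfl⟩ _ ⟨s, -, a, rfl⟩
  exact (dist_le_norm_add_norm _ _).trans (add_le_add ((norm_add_le _ _).trans
    (add_le_add (h₁ b) (hB (mem_iUnion.2 ⟨t, p, hp, rfl⟩)))) (h₂ _))

theorem vec_magnify (p d : ℤ × ℤ) :
    vec (3 * p.1 + d.1, 3 * p.2 + d.2) = (3 : ℝ) • vec p + vec d :=
  plane_ext (by simp [vec_apply_zero]) (by simp [vec_apply_one])

theorem points_subset_cluster [Finite σ] [Finite τ] (h : A.Covers v)
    (hshape : ∀ t, (A.shape t).Nonempty) (t : τ) : A.points t ⊆ A.cluster v t := by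
  obtain ⟨K, hK⟩ := A.exists_dist_le (v := v)
  refine subset_of_refinement (K := K) ?_ (A.isClosed_cluster v) ?_ t
  · rintro t _ ⟨s, hs, a, rfl⟩
    obtain ⟨p, hp⟩ := hshape t
    have hy : expand v a + vec p ∈ A.cluster v t := ⟨p, hp, a, rfl⟩
    exact ⟨_, hy, by rw [dist_comm]; exact hK t _ hy _ ⟨s, hs, a, rfl⟩⟩
  · rintro t _ ⟨s, hs, a, rfl⟩
    refine ⟨_, _, ⟨_, rfl, seqTail a, rfl⟩, _, A.point_eq s a, ?_⟩
    rintro _ ⟨c, hc, b, rfl⟩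
    obtain ⟨p, hp, j, hj⟩ := h.1 s (a 0) c hc
    refine ⟨p, hs ▸ hp, seqCons j b, ?_⟩
    have := congrArg vec hj
    rw [vec_add, vec_magnify] at this
    rw [expand_seqCons, add_assoc, add_comm (vec c), this]
    module

theorem cluster_subset_points [Finite σ] [Finite τ] (h : A.Covers v)
    (hkind : Function.Surjective A.kind) (t : τ) : A.cluster v t ⊆ A.points t := by
  obtain ⟨K, hK⟩ := A.exists_dist_le (v := v)
  refine subset_of_refinement (K := K) ?_ A.isClosed_points ?_ t
  · rintro t _ ⟨p, hp, b, rfl⟩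
    obtain ⟨s, hs⟩ := hkind t
    exact ⟨_, ⟨s, hs, b, rfl⟩, hK t _ ⟨p, hp, b, rfl⟩ _ ⟨s, hs, b, rfl⟩⟩
  · rintro t _ ⟨p, hp, b, rfl⟩
    obtain ⟨s, i, hs, ⟨c, hc, hj⟩, hall⟩ := h.2 t p hp (b 0)
    refine ⟨_, _, ⟨c, hc, seqTail b, rfl⟩, vec (A.off s i), ?_, ?_⟩
    · have := congrArg vec hj
      rw [vec_add, vec_magnify] at this
      rw [expand_eq, add_assoc, add_comm (vec c), this]
      module
    · rintro _ ⟨s', hs', a, rfl⟩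
      obtain ⟨s₂, i₂, rfl, rfl, ho⟩ := hall s' hs'
      refine ⟨s₂, rfl, seqCons i₂ a, ?_⟩
      rw [A.point_eq s₂, ← ho]
      rfl

theorem le_dist_of_separates [Finite σ] [Finite τ] {W n : ℕ} (hW : HasWidth v W)
    (h : A.Covers v) (hshape : ∀ t, (A.shape t).Nonempty) (hs : A.Separates v W n)
    {s : σ} {k : ℕ} {a b : ℕ → Fin m} (hk : ∀ i < k, a i = b i) (hne : a k ≠ b k) :
    ((3 : ℝ) ^ k)⁻¹ ≤ 3 ^ (n + 2) * dist (A.point s a) (A.point s b) := by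
  have hsep : ∀ s s' a b, (∀ p ∈ A.shape (A.kind (A.next s (a 0))),
      ∀ p' ∈ A.shape (A.kind (A.next s' (b 0))),
      separated v W n (A.off s (a 0) + p - (A.off s' (b 0) + p')) = true) →
      1 ≤ 3 ^ (n + 1) * dist (A.point s a) (A.point s' b) := by
    intro s s' a b hsep
    obtain ⟨p, hp, c, hc⟩ := points_subset_cluster h hshape _ ⟨_, rfl, seqTail a, rfl⟩
    obtain ⟨p', hp', c', hc'⟩ := points_subset_cluster h hshape _ ⟨_, rfl, seqTail b, rfl⟩
    have h1 := le_dist_of_separated hW (hsep p hp p' hp') c c'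
    have h2 : dist (A.point s a) (A.point s' b) = (3 : ℝ)⁻¹ * dist (expand v c +
        vec (A.off s (a 0) + p - (A.off s' (b 0) + p'))) (expand v c') := by
      rw [A.point_eq s, A.point_eq s', hc, hc', dist_smul₀, norm_inv, Real.norm_ofNat,
        dist_eq_norm, dist_eq_norm, vec_sub, vec_add, vec_add]
      congr 2
      abel
    rw [h2, pow_succ, mul_assoc, mul_inv_cancel_left₀ (by norm_num)]
    rwa [inv_le_iff_one_le_mul₀' (by positivity)] at h1
  induction k generalizing s a b with
  | zero =>
    rw [pow_zero, inv_one]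
    rcases hs s s rfl (a 0) (b 0) (by simpa using hne) with h1 | ⟨-, ho, hkind, hnext⟩
    · refine (hsep s s a b h1).trans (mul_le_mul_of_nonneg_right ?_ dist_nonneg)
      exact pow_le_pow_right₀ (by norm_num) (Nat.le_succ _)
    · rcases hs _ _ hkind (seqTail a 0) (seqTail b 0) (fun h => hnext (Prod.ext_iff.1 h).1)
        with h1 | ⟨heq, -⟩
      · have h2 := hsep _ _ (seqTail a) (seqTail b) h1
        rw [A.point_eq s a, A.point_eq s b, ← ho, dist_smul₀, dist_add_right, norm_inv,
          Real.norm_ofNat, pow_succ, mul_assoc, mul_inv_cancel_left₀ (by norm_num)]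
        exact h2
      · exact absurd heq hnext
  | succ k ih =>
    have h0 := hk 0 (Nat.succ_pos _)
    have := ih (s := A.next s (a 0)) (a := seqTail a) (b := seqTail b)
      (fun i hi => hk (i + 1) (Nat.succ_lt_succ hi)) hne
    rw [A.point_eq s a, A.point_eq s b, ← h0, dist_smul₀, dist_add_right, norm_inv,
      Real.norm_ofNat, pow_succ, mul_inv]
    linarith

theorem exists_dist_point_le [Finite σ] (A : Coding m σ τ) :
    ∃ C, 0 < C ∧ ∀ k s a b, (∀ i < k, a i = b i) →
      dist (A.point s a) (A.point s b) ≤ C * ((3 : ℝ) ^ k)⁻¹ := by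
  obtain ⟨K, hK0, hK⟩ := exists_norm_expand_le fun p : σ × Fin m => A.off p.1 p.2
  refine ⟨K + K + 1, by positivity, fun k => ?_⟩
  induction k with
  | zero =>
    intro s a b _
    have := (dist_le_norm_add_norm (A.point s a) (A.point s b)).trans (add_le_add (hK _) (hK _))
    rw [pow_zero, inv_one]
    linarith
  | succ k ih =>
    intro s a b hk
    have := ih (A.next s (a 0)) (seqTail a) (seqTail b)
      fun i hi => hk (i + 1) (Nat.succ_lt_succ hi)
    rw [A.point_eq s a, A.point_eq s b, ← hk 0 (Nat.succ_pos _), dist_smul₀, dist_add_right,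
      norm_inv, Real.norm_ofNat, pow_succ, mul_inv]
    linarith

/-- If every cluster is coded by its slots, the smaller clusters in it are separated, and there
is a kind of cluster with a single cell and a single slot, then the attractor is dust-like. -/
theorem isDust [Finite σ] [Finite τ] {W n : ℕ} (hW : HasWidth v W) (h : A.Covers v)
    (hshape : ∀ t, (A.shape t).Nonempty) (hs : A.Separates v W n) (s₀ : σ)
    (hkind : Function.Surjective A.kind) (huniq : ∀ s, A.kind s = A.kind s₀ → s = s₀)
    (hcell : A.shape (A.kind s₀) = {0}) : IsDust m (range (expand v)) := by
  obtain ⟨C, hC, hle⟩ := exists_dist_point_le A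
  refine ⟨A.point s₀, ?_, C + 3 ^ (n + 2), by positivity, fun k a b hk => ⟨?_, fun hne => ?_⟩⟩
  · have h1 := Subset.antisymm (points_subset_cluster h hshape (A.kind s₀))
      (cluster_subset_points h hkind (A.kind s₀))
    have h2 : A.points (A.kind s₀) = range (A.point s₀) := by
      ext x
      constructor
      · rintro ⟨s, hs, a, rfl⟩
        exact ⟨a, by rw [huniq s hs]⟩
      · rintro ⟨a, rfl⟩
        exact ⟨s₀, rfl, a, rfl⟩
    rw [← h2, h1]
    ext x
    simp [cluster, hcell, vec_zero, eq_comm]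
  · refine (hle k s₀ a b hk).trans (mul_le_mul_of_nonneg_right ?_ (by positivity))
    exact le_add_of_nonneg_right (by positivity)
  · refine (le_dist_of_separates hW h hshape hs hk hne).trans
      (mul_le_mul_of_nonneg_right ?_ dist_nonneg)
    exact le_add_of_nonneg_left hC.le

end Coding

/-! ### Dust-like digit sets -/

/-- The coding given by a list of clusters. The kinds of clusters are numbered, `shapes t` lists
the cells of the clusters of kind `t`, and a cluster has as many slots as cells. The smaller
clusters into which the magnified cluster falls apart are distributed among its slots: `parts t`
lists for each slot the kinds and positions of the clusters assigned to it. In order that each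
slot accommodates `m` letters, these clusters must have `m` cells altogether. -/
def Coding.ofLists (m : ℕ) {T : ℕ} (shapes : Fin T → List (ℤ × ℤ))
    (parts : Fin T → List (List (Fin T × ℤ × ℤ))) :
    Coding m (Σ t : Fin T, Fin (shapes t).length) (Fin T) :=
  let slots (s : Σ t : Fin T, Fin (shapes t).length) :
      List ((Σ t : Fin T, Fin (shapes t).length) × ℤ × ℤ) :=
    ((parts s.1).getD s.2 []).flatMap fun c =>
      (List.finRange (shapes c.1).length).map fun j => (⟨c.1, j⟩, c.2)
  { kind := fun s => s.1
    shape := fun t => (shapes t).toFinset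
    next := fun s i => ((slots s).getD i (s, 0)).1
    off := fun s i => ((slots s).getD i (s, 0)).2 }

theorem isDust_of_lists {m T : ℕ} {v : Fin m → ℤ × ℤ} {W n : ℕ}
    {shapes : Fin (T + 1) → List (ℤ × ℤ)}
    {parts : Fin (T + 1) → List (List (Fin (T + 1) × ℤ × ℤ))} (hW : HasWidth v W)
    (hshape : ∀ t, 0 < (shapes t).length) (hroot : shapes 0 = [0])
    (h : (Coding.ofLists m shapes parts).Covers v)
    (hs : (Coding.ofLists m shapes parts).Separates v W n) : IsDust m (range (expand v)) := by
  refine Coding.isDust hW h (fun t => ?_) hs ⟨0, ⟨0, hshape 0⟩⟩ (fun t => ⟨⟨t, ⟨0, hshape t⟩⟩, rfl⟩)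
    ?_ ?_
  · exact ⟨_, List.mem_toFinset.2 (List.getElem_mem (hshape t))⟩
  · rintro ⟨t, j⟩ ht
    obtain rfl : t = 0 := ht
    have hlen : (shapes 0).length = 1 := by rw [hroot]; rfl
    have : j = ⟨0, hshape 0⟩ := Fin.ext (by have := j.2; simp only; omega)
    rw [this]
  · change (shapes 0).toFinset = {0}
    rw [hroot]
    rfl

/-- If different cells are separated, then every cluster is a cell. -/
theorem isDust_of_separated {m : ℕ} {v : Fin m → ℤ × ℤ} {W n : ℕ} (hW : HasWidth v W)
    (h : ∀ i j, i ≠ j → separated v W n (v i - v j) = true) : IsDust m (range (expand v)) := by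
  let A : Coding m Unit Unit :=
    { kind := id, shape := fun _ => {0}, next := fun _ _ => (), off := fun _ i => v i }
  refine A.isDust hW ⟨fun s i c hc => ⟨0, Finset.mem_singleton_self _, i, ?_⟩,
    fun t p hp j => ⟨(), j, rfl, ⟨0, Finset.mem_singleton_self _, ?_⟩, fun _ _ => ⟨(), j, rfl, rfl,
    rfl⟩⟩⟩ (fun _ => ⟨0, Finset.mem_singleton_self _⟩) (n := n) (fun s s' _ i i' hne => Or.inl ?_)
    () (fun _ => ⟨(), rfl⟩) (fun _ _ => rfl) rfl
  · rw [Finset.mem_singleton.1 hc]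
    simp [A]
  · rw [Finset.mem_singleton.1 hp]
    simp [A]
  · intro p hp p' hp'
    rw [Finset.mem_singleton.1 hp, Finset.mem_singleton.1 hp', add_zero, add_zero]
    exact h i i' fun hi => hne (by rw [hi])

/-- Clusters of two cells on a common vertical occur. -/
theorem isDust_four : IsDust 4 (range (expand ![(1, 2), (0, 0), (0, 1), (1, 0)])) :=
  isDust_of_lists (W := 2) (n := 3) (T := 1)
    (shapes := ![[0], [(0, 0), (0, 1)]])
    (parts := ![[[(1, 0, 0), (0, 1, 0), (0, 1, 2)]],
      [[(1, 0, 0), (1, 0, 3)], [(1, 1, 2), (0, 1, 0), (0, 1, 5)]]])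
    (by decide +kernel) (by decide +kernel) rfl (by decide +kernel) (by decide +kernel)

/-- Clusters of two cells on a common horizontal occur. -/
theorem isDust_five_of_pairs :
    IsDust 5 (range (expand ![(-1, -1), (1, -1), (0, 0), (1, 0), (0, 1)])) :=
  isDust_of_lists (W := 2) (n := 3) (T := 1)
    (shapes := ![[0], [(0, 0), (1, 0)]])
    (parts := ![[[(1, 0, 0), (0, -1, -1), (0, 0, 1), (0, 1, -1)]],
      [[(1, 0, 0), (1, 1, -1), (0, -1, -1)], [(1, 3, 0), (0, 0, 1), (0, 3, 1), (0, 4, -1)]]])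
    (by decide +kernel) (by decide +kernel) rfl (by decide +kernel) (by decide +kernel)

/-- Clusters of one, three, four and five cells occur, those of four cells in two shapes. -/
theorem isDust_five_of_corners :
    IsDust 5 (range (expand ![(1, 2), (2, 1), (0, 0), (0, 1), (1, 0)])) :=
  isDust_of_lists (W := 2) (n := 3) (T := 4)
    (shapes := ![[0], [(0, 0), (0, 1), (1, 0)], [(0, 0), (0, 1), (1, -1), (1, 0)],
      [(0, 0), (1, -1), (1, 0), (2, -1)], [(0, 0), (1, -1), (1, 0), (2, -2), (2, -1)]])
    (parts := ![[[(1, 0, 0), (0, 1, 2), (0, 2, 1)]],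
      [[(2, 0, 3), (0, 1, 5)], [(3, 2, 1), (0, 2, 4)], [(1, 0, 0), (0, 4, 2), (0, 5, 1)]],
      [[(4, 2, 1)], [(2, 0, 3), (0, 1, 5)], [(1, 0, 0), (0, 2, 4), (0, 4, 2)],
        [(1, 3, -3), (0, 5, -2), (0, 5, 1)]],
      [[(4, 2, 1)], [(3, 5, -2), (0, 1, 2)], [(1, 0, 0), (0, 4, 2), (0, 5, 1)],
        [(1, 3, -3), (0, 7, -1), (0, 8, -2)]],
      [[(4, 2, 1)], [(4, 5, -2)], [(1, 0, 0), (0, 1, 2), (0, 4, 2)],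
        [(1, 3, -3), (0, 5, 1), (0, 7, -1)], [(1, 6, -6), (0, 8, -5), (0, 8, -2)]]])
    (by decide +kernel) (by decide +kernel) rfl (by decide +kernel) (by decide +kernel)

/-! ### Moving pieces of a set -/

/-- Each pair of points either lies in a common piece, on which `φ` and `ψ` are comparable, or its
points lie in pieces of sizes `r a` and `r b`; the pieces are displaced from `φ` to `ψ` by at most
a multiple of their sizes, and are as far from each other as their sizes, before and after. -/
theorem Comparable.of_displacement {Ω : Type*} {φ ψ : Ω → Plane} (r : Ω → ℝ) {M : ℝ}
    (hM : 0 ≤ M) (hdis : ∀ a, dist (φ a) (ψ a) ≤ M * r a)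
    (h : ∀ a b, (dist (φ a) (φ b) ≤ M * dist (ψ a) (ψ b) ∧
      dist (ψ a) (ψ b) ≤ M * dist (φ a) (φ b)) ∨
      (r a ≤ M * dist (φ a) (φ b) ∧ r a ≤ M * dist (ψ a) (ψ b))) : Comparable φ ψ := by
  have hle : M ≤ 1 + M * M + M * M + M := by nlinarith
  refine Comparable.of_le (1 + M * M + M * M + M) (1 + M * M + M * M + M) (fun a b => ?_)
    fun a b => ?_
  · rcases h a b with h1 | h1
    · exact h1.1.trans (mul_le_mul_of_nonneg_right hle dist_nonneg)
    rcases h b a with h2 | h2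
    · rw [dist_comm (φ a), dist_comm (ψ a)]
      exact h2.1.trans (mul_le_mul_of_nonneg_right hle dist_nonneg)
    rw [dist_comm (φ b), dist_comm (ψ b)] at h2
    have h3 := dist_triangle4 (φ a) (ψ a) (ψ b) (φ b)
    rw [dist_comm (ψ b)] at h3
    have h4 := mul_le_mul_of_nonneg_left h1.2 hM
    have h5 := mul_le_mul_of_nonneg_left h2.2 hM
    nlinarith [hdis a, hdis b, mul_nonneg hM (dist_nonneg (x := ψ a) (y := ψ b))]
  · rcases h a b with h1 | h1
    · exact h1.2.trans (mul_le_mul_of_nonneg_right hle dist_nonneg)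
    rcases h b a with h2 | h2
    · rw [dist_comm (φ a), dist_comm (ψ a)]
      exact h2.2.trans (mul_le_mul_of_nonneg_right hle dist_nonneg)
    rw [dist_comm (φ b), dist_comm (ψ b)] at h2
    have h3 := dist_triangle4 (ψ a) (φ a) (φ b) (ψ b)
    rw [dist_comm (ψ a) (φ a)] at h3
    have h4 := mul_le_mul_of_nonneg_left h1.1 hM
    have h5 := mul_le_mul_of_nonneg_left h2.1 hM
    nlinarith [hdis a, hdis b, mul_nonneg hM (dist_nonneg (x := φ a) (y := φ b))]

theorem abs_apply_sub_le_dist (x y : Plane) (i : Fin 2) : |x i - y i| ≤ dist x y := by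
  rw [dist_eq_norm, ← PiLp.sub_apply]
  exact abs_apply_le_norm _ i

theorem expand_apply_le {κ : Type*} [Finite κ] {w : κ → ℤ × ℤ} {i : Fin 2} {c : ℝ}
    (hw : ∀ k, vec (w k) i ≤ c) (b : ℕ → κ) : expand w b i ≤ c / 2 := by
  obtain ⟨K, hK0, hK⟩ := exists_norm_expand_le w
  refine le_of_forall_le_add_div_pow (K := K + |c|) fun n => ?_
  induction n generalizing b with
  | zero =>
    have h1 := (le_abs_self _).trans ((abs_apply_le_norm (expand w b) i).trans (hK b))
    rw [pow_zero, div_one]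
    linarith [neg_abs_le c, abs_nonneg c]
  | succ n ih =>
    rw [expand_eq w b]
    simp only [PiLp.smul_apply, PiLp.add_apply, smul_eq_mul]
    have h1 := ih (seqTail b)
    have h2 := hw (b 0)
    have h3 : (K + |c|) / 3 ^ (n + 1) = (K + |c|) / 3 ^ n / 3 := by rw [pow_succ, div_div]
    rw [h3]
    linarith

theorem le_expand_apply {κ : Type*} [Finite κ] {w : κ → ℤ × ℤ} {i : Fin 2} {c : ℝ}
    (hw : ∀ k, c ≤ vec (w k) i) (b : ℕ → κ) : c / 2 ≤ expand w b i := by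
  obtain ⟨K, hK0, hK⟩ := exists_norm_expand_le w
  refine le_of_forall_le_add_div_pow (K := K + |c|) fun n => ?_
  induction n generalizing b with
  | zero =>
    have h1 := (neg_le_abs _).trans ((abs_apply_le_norm (expand w b) i).trans (hK b))
    rw [pow_zero, div_one]
    linarith [le_abs_self c, abs_nonneg c]
  | succ n ih =>
    rw [expand_eq w b]
    simp only [PiLp.smul_apply, PiLp.add_apply, smul_eq_mul]
    have h1 := ih (seqTail b)
    have h2 := hw (b 0)
    have h3 : (K + |c|) / 3 ^ (n + 1) = (K + |c|) / 3 ^ n / 3 := by rw [pow_succ, div_div]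
    rw [h3]
    linarith

/-! ### Attractors of three collinear digits and two digits beside them -/

/-- The digits `0, 2, 4` on the axis, and the digits `p`, `q` at height `1` with first coordinate
between `0` and `3`. The attractor is a segment of length `2` and small pieces above it. -/
structure IsComb (v : Fin 5 → ℤ × ℤ) : Prop where
  row : v 0 = (0, 0) ∧ v 1 = (2, 0) ∧ v 2 = (4, 0)
  snd : (v 3).2 = 1 ∧ (v 4).2 = 1
  fst : (0 ≤ (v 3).1 ∧ (v 3).1 ≤ 3) ∧ (0 ≤ (v 4).1 ∧ (v 4).1 ≤ 3)

namespace IsComb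

variable {v v' : Fin 5 → ℤ × ℤ}

theorem expand_bounds (h : IsComb v) (b : ℕ → Fin 5) :
    (0 ≤ expand v b 0 ∧ expand v b 0 ≤ 2) ∧ (0 ≤ expand v b 1 ∧ expand v b 1 ≤ 1 / 2) := by
  have key : ∀ k, (0 ≤ (v k).1 ∧ (v k).1 ≤ 4) ∧ (0 ≤ (v k).2 ∧ (v k).2 ≤ 1) := by
    obtain ⟨⟨h0, h1, h2⟩, h3, h4⟩ := h
    intro k
    fin_cases k <;> simp only [Fin.zero_eta, Fin.mk_one, Fin.reduceFinMk, h0, h1, h2] <;> omega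
  have h1 := le_expand_apply (w := v) (i := 0) (c := 0)
    (fun k => by rw [vec_apply_zero]; exact_mod_cast (key k).1.1) b
  have h2 := expand_apply_le (w := v) (i := 0) (c := 4)
    (fun k => show ((v k).1 : ℝ) ≤ 4 by exact_mod_cast (key k).1.2) b
  have h3 := le_expand_apply (w := v) (i := 1) (c := 0)
    (fun k => by rw [vec_apply_one]; exact_mod_cast (key k).2.1) b
  have h4 := expand_apply_le (w := v) (i := 1) (c := 1)
    (fun k => show ((v k).2 : ℝ) ≤ 1 by exact_mod_cast (key k).2.2) b
  refine ⟨⟨?_, ?_⟩, ?_, ?_⟩ <;> linarith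

end IsComb

/-- The part of the attractor above the first subdivision of the segment. -/
def hang (v : Fin 5 → ℤ × ℤ) : Set Plane :=
  {x | ∃ i : Fin 5, 3 ≤ i ∧ ∃ b, x = (3 : ℝ)⁻¹ • (expand v b + vec (v i))}

/-- The copy of a point of `hang v` above the `i`-th interval of the `k`-th subdivision. -/
noncomputable def combPoint (k i : ℕ) (a : Plane) : Plane :=
  ((3 : ℝ) ^ k)⁻¹ • (a + vec (2 * (i : ℤ), 0))

theorem combPoint_apply_zero (k i : ℕ) (a : Plane) :
    combPoint k i a 0 = ((3 : ℝ) ^ k)⁻¹ * (a 0 + 2 * i) := by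
  simp [combPoint, vec_apply_zero, mul_add]

theorem combPoint_apply_one (k i : ℕ) (a : Plane) :
    combPoint k i a 1 = ((3 : ℝ) ^ k)⁻¹ * a 1 := by
  simp [combPoint, vec_apply_one]

theorem combPoint_succ (k i d : ℕ) (a : Plane) :
    combPoint (k + 1) (i + 3 ^ k * d) a =
      (3 : ℝ)⁻¹ • (combPoint k i a + vec (2 * (d : ℤ), 0)) := by
  have h : (3 : ℝ) ^ k ≠ 0 := by positivity
  refine plane_ext ?_ ?_
  · simp only [combPoint_apply_zero, PiLp.smul_apply, PiLp.add_apply, smul_eq_mul,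
      vec_apply_zero]
    push_cast
    field_simp
    ring
  · simp only [combPoint_apply_one, PiLp.smul_apply, PiLp.add_apply, smul_eq_mul,
      vec_apply_one, Int.cast_zero]
    field_simp
    ring

namespace IsComb

variable {v v' : Fin 5 → ℤ × ℤ}

theorem row_eq (h : IsComb v) {i : Fin 5} (hi : i < 3) : v i = (2 * ((i : ℕ) : ℤ), 0) := by
  obtain ⟨⟨h0, h1, h2⟩, -, -⟩ := h
  fin_cases i
  · exact h0
  · exact h1
  · exact h2
  · exact absurd hi (by decide)
  · exact absurd hi (by decide)

theorem hang_bounds (h : IsComb v) {x : Plane} (hx : x ∈ hang v) :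
    (0 ≤ x 0 ∧ x 0 ≤ 5 / 3) ∧ (1 / 3 ≤ x 1 ∧ x 1 ≤ 1 / 2) := by
  obtain ⟨i, hi, b, rfl⟩ := hx
  obtain ⟨⟨h1, h2⟩, h3, h4⟩ := h.expand_bounds b
  have key : (0 ≤ (v i).1 ∧ (v i).1 ≤ 3) ∧ (v i).2 = 1 := by
    obtain ⟨-, ⟨h3, h4⟩, h5, h6⟩ := h
    fin_cases i
    · exact absurd hi (by decide)
    · exact absurd hi (by decide)
    · exact absurd hi (by decide)
    · exact ⟨h5, h3⟩
    · exact ⟨h6, h4⟩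
  have k1 : (0 : ℝ) ≤ (v i).1 := by exact_mod_cast key.1.1
  have k2 : ((v i).1 : ℝ) ≤ 3 := by exact_mod_cast key.1.2
  simp only [PiLp.smul_apply, PiLp.add_apply, smul_eq_mul, vec_apply_zero, vec_apply_one, key.2,
    Int.cast_one]
  refine ⟨⟨?_, ?_⟩, ?_, ?_⟩ <;> linarith

theorem exists_combPoint (h : IsComb v) {b : ℕ → Fin 5} {k : ℕ} (hk : ∀ j < k, b j < 3)
    (hb : 3 ≤ b k) : ∃ i < 3 ^ k, ∃ a ∈ hang v, expand v b = combPoint k i a := by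
  induction k generalizing b with
  | zero =>
    refine ⟨0, by norm_num, expand v b, ⟨b 0, hb, seqTail b, expand_eq v b⟩, ?_⟩
    refine plane_ext ?_ ?_
    · simp [combPoint_apply_zero]
    · simp [combPoint_apply_one]
  | succ k ih =>
    obtain ⟨i, hi, a, ha, hia⟩ := ih (b := seqTail b)
      (fun j hj => hk (j + 1) (Nat.succ_lt_succ hj)) hb
    have h0 := hk 0 (Nat.succ_pos k)
    refine ⟨i + 3 ^ k * (b 0 : ℕ), ?_, a, ha, ?_⟩
    · have h1 : (b 0 : ℕ) < 3 := h0
      have h2 : 3 ^ k * (b 0 : ℕ) ≤ 3 ^ k * 2 := Nat.mul_le_mul_left _ (by omega)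
      rw [pow_succ]
      omega
    · rw [combPoint_succ, ← hia, expand_eq, h.row_eq h0]

theorem combPoint_mem (h : IsComb v) {k i : ℕ} (hi : i < 3 ^ k) {a : Plane} (ha : a ∈ hang v) :
    combPoint k i a ∈ range (expand v) := by
  induction k generalizing i with
  | zero =>
    obtain rfl : i = 0 := by simpa using hi
    obtain ⟨j, -, b, rfl⟩ := ha
    refine ⟨seqCons j b, ?_⟩
    rw [expand_seqCons]
    refine plane_ext ?_ ?_
    · simp [combPoint_apply_zero]
    · simp [combPoint_apply_one]
  | succ k ih =>
    obtain ⟨b, hb⟩ := ih (Nat.mod_lt i (by positivity))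
    have hd : i / 3 ^ k < 3 := Nat.div_lt_of_lt_mul (by rwa [pow_succ] at hi)
    refine ⟨seqCons ⟨i / 3 ^ k, by omega⟩ b, ?_⟩
    rw [expand_seqCons, hb, h.row_eq (i := ⟨i / 3 ^ k, by omega⟩) hd]
    conv_rhs => rw [← Nat.mod_add_div i (3 ^ k)]
    rw [combPoint_succ]

/-- The attractor is parametrized by its part on the axis and the copies of `hang v`. -/
theorem range_expand (h : IsComb v) : range (expand v) =
    {x | ∃ b : ℕ → Fin 5, (∀ k, b k < 3) ∧ x = expand v b} ∪
    {x | ∃ k, ∃ i < 3 ^ k, ∃ a ∈ hang v, x = combPoint k i a} := by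
  refine Subset.antisymm ?_ (union_subset ?_ ?_)
  · rintro _ ⟨b, rfl⟩
    by_cases hb : ∀ k, b k < 3
    · exact Or.inl ⟨b, hb, rfl⟩
    · push Not at hb
      classical
      exact Or.inr ⟨Nat.find hb, h.exists_combPoint
        (fun j hj => not_le.1 (Nat.find_min hb hj)) (Nat.find_spec hb)⟩
  · rintro _ ⟨b, -, rfl⟩
    exact ⟨b, rfl⟩
  · rintro _ ⟨k, i, hi, a, ha, rfl⟩
    exact h.combPoint_mem hi ha

theorem expand_eq_of_row (h : IsComb v) (h' : IsComb v') {b : ℕ → Fin 5} (hb : ∀ k, b k < 3) :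
    expand v b = expand v' b := by
  unfold expand
  exact tsum_congr fun k => by rw [h.row_eq (hb k), h'.row_eq (hb k)]

theorem expand_row_apply_one (h : IsComb v) {b : ℕ → Fin 5} (hb : ∀ k, b k < 3) :
    expand v b 1 = 0 := by
  have e : expand v b = expand (fun i : Fin 5 => (2 * ((i : ℕ) : ℤ), 0)) b := by
    unfold expand
    exact tsum_congr fun k => by rw [h.row_eq (hb k)]
  rw [e]
  have h1 := expand_apply_le (w := fun i : Fin 5 => (2 * ((i : ℕ) : ℤ), 0)) (i := 1) (c := 0)
    (fun k => by simp [vec_apply_one]) b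
  have h2 := le_expand_apply (w := fun i : Fin 5 => (2 * ((i : ℕ) : ℤ), 0)) (i := 1) (c := 0)
    (fun k => by simp [vec_apply_one]) b
  linarith

/-- Different copies of sets in the strip of `hang_bounds` are as far apart as they are large. -/
theorem le_dist_combPoint {k i j l : ℕ} (hne : (k, i) ≠ (j, l)) {a b : Plane}
    (ha : (0 ≤ a 0 ∧ a 0 ≤ 5 / 3) ∧ (1 / 3 ≤ a 1 ∧ a 1 ≤ 1 / 2))
    (hb : (0 ≤ b 0 ∧ b 0 ≤ 5 / 3) ∧ (1 / 3 ≤ b 1 ∧ b 1 ≤ 1 / 2)) :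
    ((3 : ℝ) ^ k)⁻¹ ≤ 6 * dist (combPoint k i a) (combPoint j l b) := by
  have hx := abs_apply_sub_le_dist (combPoint k i a) (combPoint j l b) 0
  have hy := abs_apply_sub_le_dist (combPoint k i a) (combPoint j l b) 1
  rw [combPoint_apply_zero, combPoint_apply_zero] at hx
  rw [combPoint_apply_one, combPoint_apply_one] at hy
  have hk : 0 < ((3 : ℝ) ^ k)⁻¹ := by positivity
  have hj : 0 < ((3 : ℝ) ^ j)⁻¹ := by positivity
  have hscale : ∀ {p q : ℕ}, p < q → 3 * ((3 : ℝ) ^ q)⁻¹ ≤ ((3 : ℝ) ^ p)⁻¹ := fun {p q} hpq => by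
    obtain ⟨r, rfl⟩ := Nat.exists_eq_add_of_lt hpq
    rw [pow_succ, mul_inv, mul_comm, inv_mul_cancel_right₀ (by norm_num)]
    exact inv_anti₀ (by positivity) (pow_le_pow_right₀ (by norm_num) (Nat.le_add_right _ _))
  rcases lt_trichotomy k j with hkj | rfl | hkj
  · have := hscale hkj
    have := (abs_le.1 hy).2
    nlinarith [ha.2.1, hb.2.2]
  · have hil : i ≠ l := fun h => hne (by rw [h])
    rw [← mul_sub, abs_mul, abs_of_pos hk] at hx
    have h1 : 1 / 3 ≤ |a 0 + 2 * i - (b 0 + 2 * l)| := by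
      rcases lt_or_gt_of_ne hil with h | h
      · have h2 : (i : ℝ) + 1 ≤ l := by exact_mod_cast h
        rw [le_abs]
        right
        linarith [ha.1.2, hb.1.1]
      · have h2 : (l : ℝ) + 1 ≤ i := by exact_mod_cast h
        rw [le_abs]
        left
        linarith [ha.1.1, hb.1.2]
    have := mul_le_mul_of_nonneg_left h1 hk.le
    linarith
  · have := hscale hkj
    have := (abs_le.1 hy).1
    nlinarith [ha.2.2, hb.2.1]

/-- Replacing each copy of `hang v` by a copy of `hang v'` is bi-Lipschitz. -/
theorem lipschitzEquivalent (h : IsComb v) (h' : IsComb v')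
    (hhang : LipschitzEquivalent (hang v) (hang v')) :
    LipschitzEquivalent (range (expand v)) (range (expand v')) := by
  obtain ⟨g, hg, C, hC, hcomp⟩ := hhang.exists_comparable
  have hmem : ∀ a, g a ∈ hang v' := fun a => hg ▸ mem_range_self a
  let Ω := {b : ℕ → Fin 5 // ∀ k, b k < 3} ⊕ (Σ k : ℕ, Fin (3 ^ k)) × hang v
  let φ : Ω → Plane := Sum.elim (fun b => expand v b.1) fun q => combPoint q.1.1 q.1.2 q.2
  let ψ : Ω → Plane := Sum.elim (fun b => expand v' b.1) fun q => combPoint q.1.1 q.1.2 (g q.2)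
  let r : Ω → ℝ := Sum.elim (fun _ => 0) fun q => ((3 : ℝ) ^ q.1.1)⁻¹
  have hφ : range φ = range (expand v) := by
    rw [h.range_expand, Sum.elim_range]
    congr 1
    · ext x
      simp [eq_comm]
    · ext x
      constructor
      · rintro ⟨⟨⟨k, i⟩, a⟩, rfl⟩
        exact ⟨k, i, i.2, a, a.2, rfl⟩
      · rintro ⟨k, i, hi, a, ha, rfl⟩
        exact ⟨⟨⟨k, ⟨i, hi⟩⟩, ⟨a, ha⟩⟩, rfl⟩
  have hψ : range ψ = range (expand v') := by
    rw [h'.range_expand, Sum.elim_range]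
    congr 1
    · ext x
      simp [eq_comm]
    · ext x
      constructor
      · rintro ⟨⟨⟨k, i⟩, a⟩, rfl⟩
        exact ⟨k, i, i.2, g a, hmem a, rfl⟩
      · rintro ⟨k, i, hi, a, ha, rfl⟩
        rw [← hg] at ha
        obtain ⟨a, rfl⟩ := ha
        exact ⟨⟨⟨k, ⟨i, hi⟩⟩, a⟩, rfl⟩
  rw [← hφ, ← hψ]
  refine (Comparable.of_displacement (φ := φ) (ψ := ψ) r (M := 6 + C) (by positivity) ?_
    ?_).lipschitzEquivalent
  · rintro (b | ⟨⟨k, i⟩, a⟩)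
    · simp [φ, ψ, r, h.expand_eq_of_row h' b.2]
    · change dist (combPoint k i a) (combPoint k i (g a)) ≤ (6 + C) * ((3 : ℝ) ^ k)⁻¹
      have h1 := h.hang_bounds a.2
      have h2 := h'.hang_bounds (hmem a)
      have h3 : dist (a : Plane) (g a) ≤ 6 := by
        rw [dist_eq_norm]
        refine (norm_le_abs_add_abs _).trans ?_
        have h4 : |((a : Plane) - g a) 0| ≤ 3 := by
          rw [PiLp.sub_apply, abs_le]
          constructor <;> linarith [h1.1.1, h1.1.2, h2.1.1, h2.1.2]
        have h5 : |((a : Plane) - g a) 1| ≤ 3 := by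
          rw [PiLp.sub_apply, abs_le]
          constructor <;> linarith [h1.2.1, h1.2.2, h2.2.1, h2.2.2]
        linarith
      rw [combPoint, combPoint, dist_smul₀, dist_add_right, norm_inv, norm_pow, Real.norm_ofNat,
        mul_comm]
      exact mul_le_mul_of_nonneg_right (h3.trans (le_add_of_nonneg_right hC.le)) (by positivity)
  · rintro (b | ⟨⟨k, i⟩, a⟩) (c | ⟨⟨j, l⟩, d⟩)
    · right
      exact ⟨by positivity, by positivity⟩
    · right
      exact ⟨by positivity, by positivity⟩
    · right
      have key : ∀ x : Plane, 1 / 3 ≤ x 1 → ∀ {w : Fin 5 → ℤ × ℤ}, IsComb w →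
          ((3 : ℝ) ^ k)⁻¹ ≤ (6 + C) * dist (combPoint k i x) (expand w c.1) := by
        intro x hx w hw
        have h1 := (le_abs_self _).trans
          (abs_apply_sub_le_dist (combPoint k i x) (expand w c.1) 1)
        rw [combPoint_apply_one, hw.expand_row_apply_one c.2, sub_zero] at h1
        have h2 : ((3 : ℝ) ^ k)⁻¹ * (1 / 3) ≤ ((3 : ℝ) ^ k)⁻¹ * x 1 :=
          mul_le_mul_of_nonneg_left hx (by positivity)
        nlinarith [mul_nonneg hC.le (dist_nonneg (x := combPoint k i x) (y := expand w c.1))]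
      exact ⟨key a (h.hang_bounds a.2).2.1 h, key (g a) (h'.hang_bounds (hmem a)).2.1 h'⟩
    · by_cases hne : (⟨k, i⟩ : Σ k : ℕ, Fin (3 ^ k)) = ⟨j, l⟩
      · left
        cases hne
        change dist (combPoint k i a) (combPoint k i d) ≤
            (6 + C) * dist (combPoint k i (g a)) (combPoint k i (g d)) ∧
          dist (combPoint k i (g a)) (combPoint k i (g d)) ≤
            (6 + C) * dist (combPoint k i a) (combPoint k i d)
        simp only [combPoint, dist_smul₀, dist_add_right, norm_inv, norm_pow, Real.norm_ofNat]
        have hk : 0 ≤ ((3 : ℝ) ^ k)⁻¹ := by positivity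
        have h1 := mul_le_mul_of_nonneg_left (hcomp a d).1 hk
        have h2 := mul_le_mul_of_nonneg_left (hcomp a d).2 hk
        have h3 := mul_nonneg hk (dist_nonneg (x := (a : Plane)) (y := d))
        have h4 := mul_nonneg hk (dist_nonneg (x := g a) (y := g d))
        constructor <;> nlinarith
      · right
        have hne' : (k, (i : ℕ)) ≠ (j, (l : ℕ)) := fun heq => hne <| by
          obtain ⟨rfl, hil⟩ := Prod.ext_iff.1 heq
          rw [Fin.ext hil]
        have h1 := le_dist_combPoint hne' (h.hang_bounds a.2) (h.hang_bounds d.2)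
        have h2 := le_dist_combPoint hne' (h'.hang_bounds (hmem a)) (h'.hang_bounds (hmem d))
        exact ⟨h1.trans (mul_le_mul_of_nonneg_right (by linarith) dist_nonneg),
          h2.trans (mul_le_mul_of_nonneg_right (by linarith) dist_nonneg)⟩

end IsComb

/-! ### Absorbing a disjoint copy -/

/-- The digits of the attractor that absorbs a disjoint copy of itself. -/
def wideDigits : Fin 5 → ℤ × ℤ := ![(0, 0), (2, 0), (4, 0), (0, 1), (3, 1)]

theorem isComb_wideDigits : IsComb wideDigits := by
  refine ⟨⟨rfl, rfl, rfl⟩, ⟨rfl, rfl⟩, ?_⟩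
  decide

/-- The image of `z` in the `k`-th of a sequence of pieces of the attractor shrinking to `0`: the
piece with the digit `(0, 1)` after `k` digits `(0, 0)`. -/
noncomputable def shrinkingPoint (k : ℕ) (z : Plane) : Plane :=
  ((3 : ℝ) ^ k)⁻¹ • (3 : ℝ)⁻¹ • (z + vec (0, 1))

theorem shrinkingPoint_apply_zero (k : ℕ) (z : Plane) :
    shrinkingPoint k z 0 = ((3 : ℝ) ^ k)⁻¹ * (z 0 / 3) := by
  simp [shrinkingPoint, vec_apply_zero]
  ring

theorem shrinkingPoint_apply_one (k : ℕ) (z : Plane) :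
    shrinkingPoint k z 1 = ((3 : ℝ) ^ k)⁻¹ * ((z 1 + 1) / 3) := by
  simp [shrinkingPoint, vec_apply_one]
  ring

theorem shrinkingPoint_succ (k : ℕ) (z : Plane) :
    shrinkingPoint (k + 1) z = (3 : ℝ)⁻¹ • shrinkingPoint k z := by
  rw [shrinkingPoint, shrinkingPoint, pow_succ', mul_inv, mul_smul]

theorem dist_shrinkingPoint (k : ℕ) (z z' : Plane) :
    dist (shrinkingPoint k z) (shrinkingPoint k z') =
      ((3 : ℝ) ^ k)⁻¹ * ((3 : ℝ)⁻¹ * dist z z') := by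
  rw [shrinkingPoint, shrinkingPoint, dist_smul₀, dist_smul₀, dist_add_right, norm_inv, norm_inv,
    norm_pow, Real.norm_ofNat]

theorem shrinkingPoint_mem (k : ℕ) (b : ℕ → Fin 5) :
    shrinkingPoint k (expand wideDigits b) ∈ range (expand wideDigits) := by
  induction k with
  | zero =>
    refine ⟨seqCons 3 b, ?_⟩
    rw [expand_seqCons, shrinkingPoint, pow_zero, inv_one, one_smul]
    rfl
  | succ k ih =>
    obtain ⟨c, hc⟩ := ih
    refine ⟨seqCons 0 c, ?_⟩
    rw [expand_seqCons, hc, shrinkingPoint_succ, isComb_wideDigits.row.1]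
    exact congrArg _ ((congrArg _ vec_zero).trans (add_zero _))

/-- A point of the attractor outside the `k`-th shrinking piece is as far from it as it is
large. -/
theorem le_dist_shrinkingPoint {k : ℕ} {b : ℕ → Fin 5}
    (hb : ∀ c, expand wideDigits b ≠ shrinkingPoint k (expand wideDigits c)) (c : ℕ → Fin 5) :
    ((3 : ℝ) ^ k)⁻¹ ≤
      6 * dist (expand wideDigits b) (shrinkingPoint k (expand wideDigits c)) := by
  have hx : ∀ (k : ℕ) (b : ℕ → Fin 5), |expand wideDigits b 0 -
      ((3 : ℝ) ^ k)⁻¹ * (expand wideDigits c 0 / 3)| ≤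
      dist (expand wideDigits b) (shrinkingPoint k (expand wideDigits c)) := fun k b => by
    rw [← shrinkingPoint_apply_zero]
    exact abs_apply_sub_le_dist _ _ 0
  have hy : ∀ (k : ℕ) (b : ℕ → Fin 5), |expand wideDigits b 1 -
      ((3 : ℝ) ^ k)⁻¹ * ((expand wideDigits c 1 + 1) / 3)| ≤
      dist (expand wideDigits b) (shrinkingPoint k (expand wideDigits c)) := fun k b => by
    rw [← shrinkingPoint_apply_one]
    exact abs_apply_sub_le_dist _ _ 1
  have e0 : ∀ b, expand wideDigits b 0 =
      3⁻¹ * (expand wideDigits (seqTail b) 0 + (wideDigits (b 0)).1) := fun b => by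
    rw [expand_eq]
    rfl
  have e1 : ∀ b, expand wideDigits b 1 =
      3⁻¹ * (expand wideDigits (seqTail b) 1 + (wideDigits (b 0)).2) := fun b => by
    rw [expand_eq]
    rfl
  obtain ⟨⟨c1, c2⟩, c3, c4⟩ := isComb_wideDigits.expand_bounds c
  induction k generalizing b with
  | zero =>
    obtain ⟨⟨t1, t2⟩, t3, t4⟩ := isComb_wideDigits.expand_bounds (seqTail b)
    have hx0 := abs_le.1 (hx 0 b)
    have hy0 := abs_le.1 (hy 0 b)
    rw [e0 b] at hx0
    rw [e1 b] at hy0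
    simp only [pow_zero, inv_one, one_mul] at hx0 hy0 ⊢
    have hdig : ∀ i, (wideDigits i).2 = 0 ∨ i = 3 ∨ i = 4 := by decide
    rcases hdig (b 0) with h | h | h
    · rw [h, Int.cast_zero] at hy0
      linarith [hy0.1]
    · refine absurd ?_ (hb (seqTail b))
      rw [expand_eq, h, shrinkingPoint, pow_zero, inv_one, one_smul]
      rfl
    · rw [h, show (wideDigits 4).1 = 3 from rfl] at hx0
      push_cast at hx0
      linarith [hx0.2]
  | succ k ih =>
    obtain ⟨⟨t1, t2⟩, t3, t4⟩ := isComb_wideDigits.expand_bounds (seqTail b)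
    have hk0 : 0 < ((3 : ℝ) ^ k)⁻¹ := by positivity
    have hk1 : ((3 : ℝ) ^ k)⁻¹ ≤ 1 := inv_le_one_of_one_le₀ (one_le_pow₀ (by norm_num))
    have hs : ((3 : ℝ) ^ (k + 1))⁻¹ = 3⁻¹ * ((3 : ℝ) ^ k)⁻¹ := by rw [pow_succ', mul_inv]
    have hx0 := abs_le.1 (hx (k + 1) b)
    have hy0 := abs_le.1 (hy (k + 1) b)
    rw [e0 b, hs] at hx0
    rw [e1 b, hs] at hy0
    have hdig : ∀ i, i = 0 ∨ 2 ≤ (wideDigits i).1 ∨ 1 ≤ (wideDigits i).2 := by decide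
    rcases hdig (b 0) with h | h | h
    · have h0 : expand wideDigits b = (3 : ℝ)⁻¹ • expand wideDigits (seqTail b) := by
        rw [expand_eq, h, isComb_wideDigits.row.1]
        exact congrArg _ ((congrArg _ vec_zero).trans (add_zero _))
      have h1 := ih (b := seqTail b) fun c hc => hb c (by rw [h0, hc, shrinkingPoint_succ])
      rw [h0, shrinkingPoint_succ, dist_smul₀, norm_inv, Real.norm_ofNat, hs]
      linarith
    · have h1 : (2 : ℝ) ≤ (wideDigits (b 0)).1 := by exact_mod_cast h
      rw [hs]
      nlinarith [hx0.2]
    · have h1 : (1 : ℝ) ≤ (wideDigits (b 0)).2 := by exact_mod_cast h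
      rw [hs]
      nlinarith [hy0.2]

/-- Adding a disjoint translate gives an equivalent set. As in Hilbert's hotel, the translate is
moved to the first of the shrinking pieces, and each shrinking piece to the next one. -/
theorem lipschitzEquivalent_union_translate :
    LipschitzEquivalent (range (expand wideDigits))
      (range (expand wideDigits) ∪ (fun x => x + vec (3, 0)) '' range (expand wideDigits)) := by
  set P := range (expand wideDigits) with hP
  have hbound : ∀ z ∈ P, (0 ≤ z 0 ∧ z 0 ≤ 2) ∧ (0 ≤ z 1 ∧ z 1 ≤ 1 / 2) := by
    rintro _ ⟨b, rfl⟩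
    exact isComb_wideDigits.expand_bounds b
  have hmem : ∀ k, ∀ z ∈ P, shrinkingPoint k z ∈ P := by
    rintro k _ ⟨b, rfl⟩
    exact shrinkingPoint_mem k b
  have hgap : ∀ k, ∀ x ∈ P, (∀ z ∈ P, x ≠ shrinkingPoint k z) → ∀ z ∈ P,
      ((3 : ℝ) ^ k)⁻¹ ≤ 6 * dist x (shrinkingPoint k z) := by
    rintro k _ ⟨b, rfl⟩ hb _ ⟨c, rfl⟩
    exact le_dist_shrinkingPoint (fun c => hb _ ⟨c, rfl⟩) c
  -- Different shrinking pieces are disjoint, as their heights show.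
  have hdisj : ∀ {j k}, j ≠ k → ∀ y ∈ P, ∀ z ∈ P, shrinkingPoint j y ≠ shrinkingPoint k z := by
    have hlt : ∀ {j k}, j < k → ∀ y ∈ P, ∀ z ∈ P, shrinkingPoint j y ≠ shrinkingPoint k z := by
      intro j k hjk y hy z hz heq
      have h1 := congrArg (fun x : Plane => x 1) heq
      simp only [shrinkingPoint_apply_one] at h1
      obtain ⟨r, rfl⟩ := Nat.exists_eq_add_of_lt hjk
      have hj : 0 < ((3 : ℝ) ^ j)⁻¹ := by positivity
      have h2 : ((3 : ℝ) ^ (j + r + 1))⁻¹ ≤ 3⁻¹ * ((3 : ℝ) ^ j)⁻¹ := by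
        rw [pow_succ', mul_inv]
        exact mul_le_mul_of_nonneg_left (inv_anti₀ (by positivity)
          (pow_le_pow_right₀ (by norm_num) (Nat.le_add_right _ _))) (by norm_num)
      have hy' := (hbound y hy).2.1
      have hz' := (hbound z hz).2.2
      have hz'' := (hbound z hz).2.1
      nlinarith
    intro j k hjk y hy z hz
    rcases lt_or_gt_of_ne hjk with h | h
    · exact hlt h y hy z hz
    · exact (hlt h z hz y hy).symm
  let R := {x : Plane // x ∈ P ∧ ∀ k, ∀ z ∈ P, x ≠ shrinkingPoint k z}
  let move : ℕ → Plane → Plane := fun k z => match k with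
    | 0 => z + vec (3, 0)
    | k + 1 => shrinkingPoint k z
  let φ : R ⊕ ℕ × P → Plane := Sum.elim (fun x => x) fun q => shrinkingPoint q.1 q.2
  let ψ : R ⊕ ℕ × P → Plane := Sum.elim (fun x => x) fun q => move q.1 q.2
  let r : R ⊕ ℕ × P → ℝ := Sum.elim (fun _ => 0) fun q => ((3 : ℝ) ^ q.1)⁻¹
  have hφ : range φ = P := by
    refine Subset.antisymm ?_ fun x hx => ?_
    · rintro _ ⟨x | ⟨k, z⟩, rfl⟩
      · exact x.2.1
      · exact hmem k z z.2
    · by_cases h : ∀ k, ∀ z ∈ P, x ≠ shrinkingPoint k z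
      · exact ⟨Sum.inl ⟨x, hx, h⟩, rfl⟩
      · push Not at h
        obtain ⟨k, z, hz, rfl⟩ := h
        exact ⟨Sum.inr (k, ⟨z, hz⟩), rfl⟩
  have hψ : range ψ = P ∪ (fun x => x + vec (3, 0)) '' P := by
    refine Subset.antisymm ?_ (union_subset (fun x hx => ?_) ?_)
    · rintro _ ⟨x | ⟨_ | k, z⟩, rfl⟩
      · exact Or.inl x.2.1
      · exact Or.inr ⟨z, z.2, rfl⟩
      · exact Or.inl (hmem k z z.2)
    · by_cases h : ∀ k, ∀ z ∈ P, x ≠ shrinkingPoint k z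
      · exact ⟨Sum.inl ⟨x, hx, h⟩, rfl⟩
      · push Not at h
        obtain ⟨k, z, hz, rfl⟩ := h
        exact ⟨Sum.inr (k + 1, ⟨z, hz⟩), rfl⟩
    · rintro _ ⟨z, hz, rfl⟩
      exact ⟨Sum.inr (0, ⟨z, hz⟩), rfl⟩
  -- The gaps before and after the move.
  have hgapψ : ∀ k, ∀ x ∈ P, (∀ j z, k = j + 1 → z ∈ P → x ≠ shrinkingPoint j z) → ∀ z ∈ P,
      ((3 : ℝ) ^ k)⁻¹ ≤ 6 * dist (move k z) x := by
    intro k x hx hne z hz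
    rcases k with _ | k
    · have h1 := (le_abs_self _).trans (abs_apply_sub_le_dist (z + vec (3, 0)) x 0)
      rw [PiLp.add_apply, vec_apply_zero] at h1
      have h2 := (hbound x hx).1.2
      have h3 := (hbound z hz).1.1
      push_cast at h1
      rw [pow_zero, inv_one]
      change 1 ≤ 6 * dist (z + vec (3, 0)) x
      linarith
    · have h1 := hgap k x hx (fun z hz => hne k z rfl hz) z hz
      rw [dist_comm] at h1
      exact (inv_anti₀ (by positivity) (pow_le_pow_right₀ (by norm_num) (Nat.le_succ k))).trans h1
  have hmove : ∀ k z z', dist (move k z) (move k z') =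
      3 * dist (shrinkingPoint k z) (shrinkingPoint k z') := by
    intro k z z'
    rcases k with _ | k
    · change dist (z + vec (3, 0)) (z' + vec (3, 0)) = _
      rw [dist_add_right, dist_shrinkingPoint]
      ring
    · change dist (shrinkingPoint k z) (shrinkingPoint k z') = _
      rw [dist_shrinkingPoint, dist_shrinkingPoint, pow_succ]
      ring
  have hdis : ∀ k, ∀ z ∈ P, dist (shrinkingPoint k z) (move k z) ≤ 8 * ((3 : ℝ) ^ k)⁻¹ := by
    intro k z hz
    obtain ⟨⟨z1, z2⟩, z3, z4⟩ := hbound z hz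
    rw [dist_eq_norm]
    refine (norm_le_abs_add_abs _).trans ?_
    rw [PiLp.sub_apply, PiLp.sub_apply]
    rcases k with _ | k
    · change |shrinkingPoint 0 z 0 - (z + vec (3, 0)) 0| +
        |shrinkingPoint 0 z 1 - (z + vec (3, 0)) 1| ≤ _
      rw [PiLp.add_apply, PiLp.add_apply, shrinkingPoint_apply_zero, shrinkingPoint_apply_one,
        vec_apply_zero, vec_apply_one, pow_zero, inv_one]
      push_cast
      have h1 : |1 * (z 0 / 3) - (z 0 + 3)| ≤ 6 := by
        rw [abs_le]
        constructor <;> linarith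
      have h2 : |1 * ((z 1 + 1) / 3) - (z 1 + 0)| ≤ 2 := by
        rw [abs_le]
        constructor <;> linarith
      linarith
    · change |shrinkingPoint (k + 1) z 0 - shrinkingPoint k z 0| +
        |shrinkingPoint (k + 1) z 1 - shrinkingPoint k z 1| ≤ _
      have hk : 0 < ((3 : ℝ) ^ (k + 1))⁻¹ := by positivity
      have hs : ((3 : ℝ) ^ k)⁻¹ = 3 * ((3 : ℝ) ^ (k + 1))⁻¹ := by
        rw [pow_succ, mul_inv]
        ring
      simp only [shrinkingPoint_apply_zero, shrinkingPoint_apply_one, hs]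
      have h1 : |((3 : ℝ) ^ (k + 1))⁻¹ * (z 0 / 3) - 3 * ((3 : ℝ) ^ (k + 1))⁻¹ * (z 0 / 3)| ≤
          4 * ((3 : ℝ) ^ (k + 1))⁻¹ := by
        rw [abs_le]
        constructor <;> nlinarith
      have h2 : |((3 : ℝ) ^ (k + 1))⁻¹ * ((z 1 + 1) / 3) -
          3 * ((3 : ℝ) ^ (k + 1))⁻¹ * ((z 1 + 1) / 3)| ≤ 4 * ((3 : ℝ) ^ (k + 1))⁻¹ := by
        rw [abs_le]
        constructor <;> nlinarith
      linarith
  have key : LipschitzEquivalent (range φ) (range ψ) := by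
    refine (Comparable.of_displacement (φ := φ) (ψ := ψ) r (M := 8) (by norm_num) ?_
      ?_).lipschitzEquivalent
    · rintro (x | ⟨k, z⟩)
      · simp [φ, ψ, r]
      · exact hdis k z z.2
    · have h68 : ∀ {t d : ℝ}, t ≤ 6 * d → 0 ≤ d → t ≤ 8 * d := fun h h' => by linarith
      rintro (x | ⟨k, z⟩) (y | ⟨j, w⟩)
      · left
        have h := dist_nonneg (x := (x : Plane)) (y := y)
        change dist (x : Plane) y ≤ 8 * dist (x : Plane) y ∧
          dist (x : Plane) y ≤ 8 * dist (x : Plane) y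
        constructor <;> linarith
      · right
        exact ⟨by positivity, by positivity⟩
      · right
        refine ⟨h68 ?_ dist_nonneg, h68 ?_ dist_nonneg⟩
        · have := hgap k y y.2.1 (y.2.2 k) z z.2
          rw [dist_comm] at this
          exact this
        · exact hgapψ k y y.2.1 (fun j z _ hz => y.2.2 j z hz) z z.2
      · rcases eq_or_ne k j with rfl | hkj
        · left
          have h := hmove k z w
          have h' := dist_nonneg (x := shrinkingPoint k z) (y := shrinkingPoint k w)
          change dist (shrinkingPoint k z) (shrinkingPoint k w) ≤ 8 * dist (move k z) (move k w) ∧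
            dist (move k z) (move k w) ≤ 8 * dist (shrinkingPoint k z) (shrinkingPoint k w)
          constructor <;> linarith
        · right
          refine ⟨h68 ?_ dist_nonneg, h68 ?_ dist_nonneg⟩
          · have := hgap k (shrinkingPoint j w) (hmem j w w.2)
              (fun z hz => hdisj hkj.symm w w.2 z hz) z z.2
            rw [dist_comm] at this
            exact this
          · rcases j with _ | j
            · obtain ⟨k, rfl⟩ := Nat.exists_eq_succ_of_ne_zero hkj
              have h1 := hgapψ 0 (shrinkingPoint k z) (hmem k z z.2)
                (fun j _ h0 => absurd h0 (Nat.succ_ne_zero j).symm) w w.2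
              rw [dist_comm] at h1
              exact (inv_anti₀ (by positivity)
                (pow_le_pow_right₀ (by norm_num) (Nat.zero_le _))).trans h1
            · exact hgapψ k (shrinkingPoint j w) (hmem j w w.2)
                (fun i u hi hu => hdisj (fun hji => hkj (by rw [hi, hji])) w w.2 u hu) z z.2
  rwa [hφ, hψ] at key

/-! ### An exceptional equivalence -/

theorem lipschitzEquivalent_image {E : Set Plane} {c : ℝ} (hc : 0 < c) (p : Plane) :
    LipschitzEquivalent E ((fun x => c • (x + p)) '' E) := by
  have h : Comparable (fun x : E => (x : Plane)) fun x : E => c • ((x : Plane) + p) := by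
    refine Comparable.of_le c⁻¹ c (fun x y => ?_) fun x y => ?_ <;>
      rw [dist_smul₀, dist_add_right, Real.norm_of_nonneg hc.le]
    rw [inv_mul_cancel_left₀ hc.ne']
  have h1 := h.lipschitzEquivalent
  rw [Subtype.range_coe] at h1
  convert h1 using 1
  rw [image_eq_range]

/-- The part above the segment consists of two pieces, which are small copies of the attractor. -/
theorem lipschitzEquivalent_hang {v : Fin 5 → ℤ × ℤ} :
    LipschitzEquivalent
      (range (expand v) ∪ (fun x => x + vec (v 4 - v 3)) '' range (expand v)) (hang v) := by
  have h : hang v = (fun x => (3 : ℝ)⁻¹ • (x + vec (v 3))) ''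
      (range (expand v) ∪ (fun x => x + vec (v 4 - v 3)) '' range (expand v)) := by
    ext x
    constructor
    · rintro ⟨i, hi, b, rfl⟩
      have h34 : ∀ i : Fin 5, 3 ≤ i → i = 3 ∨ i = 4 := by decide
      rcases h34 i hi with rfl | rfl
      · exact ⟨_, Or.inl ⟨b, rfl⟩, rfl⟩
      · refine ⟨_, Or.inr ⟨_, ⟨b, rfl⟩, rfl⟩, ?_⟩
        simp only [vec_sub, add_assoc, sub_add_cancel]
    · rintro ⟨_, ⟨b, rfl⟩ | ⟨_, ⟨b, rfl⟩, rfl⟩, rfl⟩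
      · exact ⟨3, le_rfl, b, rfl⟩
      · refine ⟨4, by decide, b, ?_⟩
        simp only [vec_sub, add_assoc, sub_add_cancel]
  rw [h]
  exact lipschitzEquivalent_image (by norm_num) _

/-- The digits of a segment with two adjacent cells above it, stretched horizontally by `2`. -/
def adjacentDigits : Fin 5 → ℤ × ℤ := ![(0, 0), (2, 0), (4, 0), (0, 1), (2, 1)]

theorem isComb_adjacentDigits : IsComb adjacentDigits := by
  refine ⟨⟨rfl, rfl, rfl⟩, ⟨rfl, rfl⟩, ?_⟩
  decide

/-- Two adjacent copies of the attractor of `adjacentDigits` form the attractor of `wideDigits`,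
stretched horizontally by `2`. -/
theorem adjacent_union_translate :
    range (expand adjacentDigits) ∪ (fun x => x + vec (2, 0)) '' range (expand adjacentDigits) =
      range (expand ![(0, 0), (4, 0), (8, 0), (0, 1), (6, 1)]) := by
  let A : Coding 5 Unit Unit :=
    { kind := id
      shape := fun _ => {(0, 0), (2, 0)}
      next := fun _ _ => ()
      off := fun _ i => ![(0, 0), (4, 0), (8, 0), (0, 1), (6, 1)] i }
  have hA : A.Covers adjacentDigits := by decide +kernel
  have h := Subset.antisymm (Coding.cluster_subset_points hA Function.surjective_id ())
    (Coding.points_subset_cluster hA (fun _ => ⟨(0, 0), Finset.mem_insert_self _ _⟩) ())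
  have hrun : ∀ a, A.point () a = expand ![(0, 0), (4, 0), (8, 0), (0, 1), (6, 1)] a := by
    intro a
    have hrun' : ∀ k a, A.run () a k = ((), a k) := by
      intro k
      induction k with
      | zero => exact fun _ => rfl
      | succ k ih => exact fun a => ih (seqTail a)
    unfold Coding.point expand
    exact tsum_congr fun k => by rw [hrun']
  have h1 : A.cluster adjacentDigits () = range (expand adjacentDigits) ∪
      (fun x => x + vec (2, 0)) '' range (expand adjacentDigits) := by
    ext x
    constructor
    · rintro ⟨p, hp, b, rfl⟩
      rcases Finset.mem_insert.1 hp with rfl | hp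
      · exact Or.inl ⟨b, ((congrArg _ vec_zero).trans (add_zero _)).symm⟩
      · rw [Finset.mem_singleton.1 hp]
        exact Or.inr ⟨_, ⟨b, rfl⟩, rfl⟩
    · rintro (⟨b, rfl⟩ | ⟨_, ⟨b, rfl⟩, rfl⟩)
      · exact ⟨(0, 0), Finset.mem_insert_self _ _, b,
          ((congrArg _ vec_zero).trans (add_zero _)).symm⟩
      · exact ⟨(2, 0), Finset.mem_insert_of_mem (Finset.mem_singleton_self _), b, rfl⟩
  rw [← h1, h]
  ext x
  constructor
  · rintro ⟨s, -, a, rfl⟩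
    exact ⟨a, (hrun a).symm⟩
  · rintro ⟨a, rfl⟩
    exact ⟨(), rfl, a, (hrun a).symm⟩

/-- The part of each attractor above the segment is equivalent to the attractor of
`wideDigits`, in one case after absorbing a copy. -/
theorem lipschitzEquivalent_adjacentDigits_wideDigits :
    LipschitzEquivalent (range (expand adjacentDigits)) (range (expand wideDigits)) := by
  refine isComb_adjacentDigits.lipschitzEquivalent isComb_wideDigits ?_
  have h1 : LipschitzEquivalent (range (expand wideDigits)) (hang adjacentDigits) := by
    refine LipschitzEquivalent.trans ?_ lipschitzEquivalent_hang
    change LipschitzEquivalent _ (range (expand adjacentDigits) ∪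
      (fun x => x + vec (2, 0)) '' range (expand adjacentDigits))
    rw [adjacent_union_translate]
    exact lipschitzEquivalent_of_affine 0 (2, 0) (0, 1) (by decide) (by decide)
  have h2 : LipschitzEquivalent (range (expand wideDigits)) (hang wideDigits) :=
    lipschitzEquivalent_union_translate.trans lipschitzEquivalent_hang
  exact h1.symm.trans h2

/-- A segment with two adjacent cells on one side, and a segment with two cells on different
sides. -/
theorem lipschitzEquivalent_same_side_opposite_sides :
    LipschitzEquivalent (range (expand ![(0, 0), (1, 0), (2, 0), (0, 1), (1, 1)]))
      (range (expand ![(-1, 0), (0, 0), (1, 0), (0, 1), (1, -1)])) := by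
  refine (lipschitzEquivalent_of_affine (v' := adjacentDigits) 0 (2, 0) (0, 1) (by decide)
    (by decide)).trans (lipschitzEquivalent_adjacentDigits_wideDigits.trans ?_)
  exact lipschitzEquivalent_of_neighbours (W := 4) (W' := 2) (n := 3) (by decide) (by decide)
    {((0, 0), (0, 0)), ((2, 0), (1, 0)), ((-2, 0), (-1, 0))} (by decide) (by decide +kernel)

/-! ### Attractors containing a segment -/

/-- An attractor with three equidistant digits on a line contains a segment. -/
theorem segment_subset_range_expand {κ : Type*} [Finite κ] {v : κ → ℤ × ℤ} {i j k : κ}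
    (hi : v i = (0, 0)) (hj : v j = (1, 0)) (hk : v k = (2, 0)) :
    {x : Plane | (0 ≤ x 0 ∧ x 0 ≤ 1) ∧ x 1 = 0} ⊆ range (expand v) := by
  obtain ⟨K, -, hK⟩ := exists_norm_expand_le v
  have hstep : ∀ x : Plane, (0 ≤ x 0 ∧ x 0 ≤ 1) ∧ x 1 = 0 →
      ∃ x' : Plane, ((0 ≤ x' 0 ∧ x' 0 ≤ 1) ∧ x' 1 = 0) ∧
        ∃ l, x = (3 : ℝ)⁻¹ • (x' + vec (v l)) := by
    rintro x ⟨⟨h0, h1⟩, h2⟩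
    have key : ∀ c : ℤ, ∀ l, v l = (c, 0) → c ≤ 3 * x 0 → 3 * x 0 ≤ c + 1 →
        ∃ x' : Plane, ((0 ≤ x' 0 ∧ x' 0 ≤ 1) ∧ x' 1 = 0) ∧
          ∃ l, x = (3 : ℝ)⁻¹ • (x' + vec (v l)) := by
      intro c l hl hc hc'
      refine ⟨!₂[3 * x 0 - c, 0], ⟨⟨?_, ?_⟩, rfl⟩, l, plane_ext ?_ ?_⟩
      · change 0 ≤ 3 * x 0 - c
        linarith
      · change 3 * x 0 - c ≤ 1
        linarith
      · rw [hl]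
        simp [vec_apply_zero]
        ring
      · rw [hl, h2]
        simp [vec_apply_one]
    by_cases hx : 3 * x 0 ≤ 1
    · exact key 0 i hi (by push_cast; linarith) (by push_cast; linarith)
    · by_cases hx' : 3 * x 0 ≤ 2
      · exact key 1 j hj (by push_cast; linarith) (by push_cast; linarith)
      · exact key 2 k hk (by push_cast; linarith) (by push_cast; linarith)
  refine subset_of_refinement (τ := Unit) (K := 1 + K)
    (X := fun _ => {x : Plane | (0 ≤ x 0 ∧ x 0 ≤ 1) ∧ x 1 = 0}) (Y := fun _ => range (expand v))
    (fun _ x hx => ?_) (fun _ => (isCompact_range_expand v).isClosed) (fun _ x hx => ?_) ()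
  · refine ⟨_, ⟨fun _ => i, rfl⟩, (dist_le_norm_add_norm _ _).trans (add_le_add ?_ (hK _))⟩
    refine (norm_le_abs_add_abs x).trans ?_
    rw [hx.2, abs_zero, add_zero, abs_of_nonneg hx.1.1]
    exact hx.1.2
  · obtain ⟨x', hx', l, rfl⟩ := hstep x hx
    refine ⟨(), x', hx', _, rfl, ?_⟩
    rintro _ ⟨b, rfl⟩
    exact ⟨seqCons l b, expand_seqCons v l b⟩

theorem not_isDust_of_segment {κ : Type*} [Finite κ] {v : κ → ℤ × ℤ} {i j k : κ}
    (hi : v i = (0, 0)) (hj : v j = (1, 0)) (hk : v k = (2, 0)) (m : ℕ) :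
    ¬ IsDust m (range (expand v)) := by
  intro h
  let γ : unitInterval → Plane := fun t => !₂[(t : ℝ), 0]
  have hγ : Continuous γ := by fun_prop
  have h01 := h.path_eq hγ
    (fun t => segment_subset_range_expand hi hj hk ⟨⟨t.2.1, t.2.2⟩, rfl⟩) 0 1
  have := congrArg (fun x : Plane => x 0) h01
  simp [γ] at this

/-! ### Classification of the digit sets -/

/-- The affine map with value `p` at `0` and linear part `(1, 0) ↦ a`, `(0, 1) ↦ b` is bijective
and carries the digits of `v` into `L`. -/
def Carries {m : ℕ} (v : Fin m → ℤ × ℤ) (L : List (ℕ × ℕ)) (p a b : ℤ × ℤ) : Prop :=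
  a.1 * b.2 - a.2 * b.1 ≠ 0 ∧ ∀ i, ∃ d ∈ L,
    (d.1 : ℤ) = p.1 + (v i).1 * a.1 + (v i).2 * b.1 ∧
    (d.2 : ℤ) = p.2 + (v i).1 * a.2 + (v i).2 * b.2

instance {m : ℕ} (v : Fin m → ℤ × ℤ) (L : List (ℕ × ℕ)) (p a b : ℤ × ℤ) :
    Decidable (Carries v L p a b) := by
  delta Carries
  infer_instance

theorem Carries.lipschitzEquivalent {m : ℕ} {v : Fin m → ℤ × ℤ} {L : List (ℕ × ℕ)}
    {p a b : ℤ × ℤ} (h : Carries v L p a b) (hv : Function.Injective v)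
    (hL : L.toFinset.card = m) {F : Set Plane} (hF : IsSelfSimilarSet 3 L.toFinset F) :
    LipschitzEquivalent F (range (expand v)) := by
  obtain ⟨hdet, h⟩ := h
  choose u huL hu1 hu2 using h
  have hinj : Function.Injective u := fun i j hij => hv <| by
    have e1 : (v i).1 * a.1 + (v i).2 * b.1 = (v j).1 * a.1 + (v j).2 * b.1 := by
      have h1 := hu1 i
      rw [hij, hu1 j] at h1
      linarith
    have e2 : (v i).1 * a.2 + (v i).2 * b.2 = (v j).1 * a.2 + (v j).2 * b.2 := by
      have h2 := hu2 i
      rw [hij, hu2 j] at h2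
      linarith
    refine Prod.ext (mul_right_cancel₀ hdet ?_) (mul_right_cancel₀ hdet ?_)
    · linear_combination b.2 * e1 - b.1 * e2
    · linear_combination a.1 * e2 - a.2 * e1
  have himage : Finset.univ.image u = L.toFinset := by
    refine Finset.eq_of_subset_of_card_le (fun d hd => ?_) ?_
    · obtain ⟨i, -, rfl⟩ := Finset.mem_image.1 hd
      exact List.mem_toFinset.2 (huL i)
    · rw [Finset.card_image_of_injective _ hinj, Finset.card_univ, Fintype.card_fin, hL]
  have hF' : F = range (expand fun i => (((u i).1 : ℤ), ((u i).2 : ℤ))) := by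
    refine hF.eq_range_expand fun z => ?_
    rw [← himage]
    simp
  rw [hF']
  refine (lipschitzEquivalent_of_affine p a b hdet fun i => ?_).symm
  refine Prod.ext ?_ ?_
  · simp [hu1 i]
  · simp [hu2 i]

/-- The points of `{0, 1, 2}²`. -/
def gridDigits : List (ℕ × ℕ) :=
  [(0, 0), (1, 0), (2, 0), (0, 1), (1, 1), (2, 1), (0, 2), (1, 2), (2, 2)]

/-- The `m`-element subsets of `{0, 1, 2}²`, as lists. -/
def digitLists (m : ℕ) : List (List (ℕ × ℕ)) :=
  List.sublistsLen m gridDigits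

theorem exists_digitList {m : ℕ} {F : Set Plane} (hF : F ∈ fractalSquares 3 m) :
    ∃ L ∈ digitLists m, L.toFinset.card = m ∧ IsSelfSimilarSet 3 L.toFinset F := by
  obtain ⟨D, hsub, hD, hF⟩ := hF
  have hgrid : Finset.range 3 ×ˢ Finset.range 3 = gridDigits.toFinset := by decide
  have hL : (gridDigits.filter (· ∈ D)).toFinset = D := by
    ext d
    have h1 : d ∈ D → d ∈ gridDigits := fun h => by
      have := hsub.subset h
      rwa [hgrid, List.mem_toFinset] at this
    simpa using h1
  refine ⟨gridDigits.filter (· ∈ D), List.mem_sublistsLen.2 ⟨List.filter_sublist, ?_⟩, ?_, ?_⟩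
  · have hnodup : (gridDigits.filter (· ∈ D)).Nodup := List.Nodup.filter _ (by decide)
    rw [← List.toFinset_card_of_nodup hnodup, hL, hD]
  · rw [hL, hD]
  · rwa [hL]

/-- The image of `z` under the affine map with `(0, 0) ↦ p`, `(1, 0) ↦ q`, `(0, 1) ↦ r`. -/
def imageDigit (p q r : ℕ × ℕ) (z : ℤ × ℤ) : ℤ × ℤ :=
  ((1 - z.1 - z.2) * p.1 + z.1 * q.1 + z.2 * r.1, (1 - z.1 - z.2) * p.2 + z.1 * q.2 + z.2 * r.2)

/-- The digit sets in `l` together with the bijective affine maps, given by the images `p`, `q`,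
`r` of `(0, 0)`, `(1, 0)`, `(0, 1)`, that place them inside `{0, 1, 2}²`. -/
def placements {m : ℕ} (l : List (Fin m → ℤ × ℤ)) :
    List ((Fin m → ℤ × ℤ) × (ℕ × ℕ) × (ℕ × ℕ) × (ℕ × ℕ)) :=
  l.flatMap fun v => gridDigits.flatMap fun p => gridDigits.flatMap fun q =>
    (gridDigits.filter fun r =>
      ((q.1 : ℤ) - p.1) * ((r.2 : ℤ) - p.2) ≠ ((q.2 : ℤ) - p.2) * ((r.1 : ℤ) - p.1) ∧
      ∀ i, (0 ≤ (imageDigit p q r (v i)).1 ∧ (imageDigit p q r (v i)).1 ≤ 2) ∧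
        (0 ≤ (imageDigit p q r (v i)).2 ∧ (imageDigit p q r (v i)).2 ≤ 2)).map fun r => (v, p, q, r)

/-- The bit mask of a subset of `{0, 1, 2}²`. -/
def digitSetCode (l : List (ℤ × ℤ)) : ℕ :=
  l.foldr (fun z n => 2 ^ (z.1 + 3 * z.2).toNat + n) 0

/-- Some placement carries a digit set of `l` into `L`. The comparison of bit masks is implied by
the last condition when `L` has `m` elements; it makes the property quick to decide. -/
def HasPlacement {m : ℕ} (l : List (Fin m → ℤ × ℤ)) (L : List (ℕ × ℕ)) : Prop :=
  ∃ f ∈ placements l,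
    Nat.beq (digitSetCode (L.map fun d => ((d.1 : ℤ), (d.2 : ℤ))))
      (digitSetCode ((List.finRange m).map fun i =>
        imageDigit f.2.1 f.2.2.1 f.2.2.2 (f.1 i))) = true ∧
    Carries f.1 L (f.2.1.1, f.2.1.2)
      ((f.2.2.1.1 : ℤ) - f.2.1.1, (f.2.2.1.2 : ℤ) - f.2.1.2)
      ((f.2.2.2.1 : ℤ) - f.2.1.1, (f.2.2.2.2 : ℤ) - f.2.1.2)

instance {m : ℕ} (l : List (Fin m → ℤ × ℤ)) (L : List (ℕ × ℕ)) : Decidable (HasPlacement l L) := by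
  delta HasPlacement
  infer_instance

theorem HasPlacement.exists_lipschitzEquivalent {m : ℕ} {l : List (Fin m → ℤ × ℤ)}
    {L : List (ℕ × ℕ)} (h : HasPlacement l L) (hinj : ∀ v ∈ l, Function.Injective v)
    (hL : L.toFinset.card = m) {F : Set Plane} (hF : IsSelfSimilarSet 3 L.toFinset F) :
    ∃ v ∈ l, LipschitzEquivalent F (range (expand v)) := by
  obtain ⟨f, hf, -, hc⟩ := h
  have hmem : f.1 ∈ l := by
    simp only [placements, List.mem_flatMap, List.mem_map] at hf
    obtain ⟨v, hv, p, -, q, -, r, -, rfl⟩ := hf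
    exact hv
  exact ⟨f.1, hmem, hc.lipschitzEquivalent (hinj _ hmem) hL hF⟩

theorem range_expand_mem_fractalSquares {m : ℕ} [NeZero m] {v : Fin m → ℤ × ℤ}
    (u : Fin m → ℕ × ℕ) (hu : Function.Injective u)
    (hgrid : Finset.univ.image u ⊂ Finset.range 3 ×ˢ Finset.range 3)
    (hv : ∀ i, v i = (((u i).1 : ℤ), ((u i).2 : ℤ))) :
    range (expand v) ∈ fractalSquares 3 m := by
  refine ⟨_, hgrid, ?_, isSelfSimilarSet_range_expand fun z => ?_⟩
  · rw [Finset.card_image_of_injective _ hu, Finset.card_univ, Fintype.card_fin]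
  · simp [hv]

theorem hasPlacement_two : ∀ L ∈ digitLists 2, HasPlacement [![(0, 0), (1, 0)]] L := by
  decide +kernel

theorem hasPlacement_three : ∀ L ∈ digitLists 3,
    HasPlacement [![(0, 0), (1, 0), (0, 1)], ![(0, 0), (1, 0), (2, 0)]] L := by
  decide +kernel

/-- The digit sets with four elements in which no three are collinear and equidistant, up to
affine equivalence, apart from the one of `isDust_four`. -/
def fourDigits : List (Fin 4 → ℤ × ℤ) :=
  [![(1, 1), (0, 0), (1, 0), (0, 1)], ![(2, 2), (0, 0), (1, 0), (0, 1)],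
    ![(2, 3), (0, 0), (1, 0), (0, 1)], ![(-2, -1), (0, 0), (1, 0), (0, 1)],
    ![(-1, -1), (0, 0), (1, 0), (0, 1)]]

theorem isDust_of_mem_fourDigits {v : Fin 4 → ℤ × ℤ} (hv : v ∈ fourDigits) :
    IsDust 4 (range (expand v)) := by
  have h : ∀ v ∈ fourDigits, HasWidth v 3 := by decide +kernel
  have h' : ∀ v ∈ fourDigits, ∀ j k, j ≠ k → separated v 3 4 (v j - v k) = true := by
    decide +kernel
  exact isDust_of_separated (h v hv) (h' v hv)

theorem hasPlacement_four : ∀ L ∈ digitLists 4,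
    HasPlacement (![(2, 0), (0, 0), (1, 0), (0, 1)] :: ![(1, 2), (0, 0), (0, 1), (1, 0)] ::
      fourDigits) L := by
  decide +kernel

/-- Digit sets with five elements that represent the affine equivalence classes, apart from three
of them whose attractors turn out to be equivalent to the attractors of the first or of the last
one here. -/
def fiveDigits : List (Fin 5 → ℤ × ℤ) :=
  [![(-1, 0), (0, 0), (1, 0), (0, 1), (1, -1)], ![(-1, 0), (2, 1), (0, 0), (1, 0), (0, 1)],
    ![(-1, 0), (1, 2), (0, 0), (1, 0), (0, 1)], ![(-1, 0), (2, 2), (0, 0), (1, 0), (0, 1)],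
    ![(2, 0), (2, 2), (0, 0), (1, 0), (0, 1)], ![(-1, 0), (0, 2), (0, 0), (1, 0), (0, 1)],
    ![(0, -1), (-2, -1), (0, 0), (0, 1), (1, 0)], ![(-1, 0), (0, -1), (0, 0), (1, 0), (0, 1)],
    ![(1, 2), (3, 2), (0, 0), (0, 1), (1, 0)], ![(2, 2), (3, 2), (0, 0), (1, 0), (0, 1)]]

theorem isDust_five_of_cells :
    IsDust 5 (range (expand ![(2, 2), (3, 2), (0, 0), (1, 0), (0, 1)])) :=
  isDust_of_separated (W := 3) (n := 5) (by decide +kernel) (by decide +kernel)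

theorem hasPlacement_five : ∀ L ∈ digitLists 5,
    HasPlacement (![(0, 0), (1, 0), (2, 0), (0, 1), (1, 1)] ::
      ![(1, 2), (2, 1), (0, 0), (0, 1), (1, 0)] ::
      ![(-1, -1), (1, -1), (0, 0), (1, 0), (0, 1)] :: fiveDigits) L := by
  decide +kernel

/-! ### Counting classes -/

theorem numLipschitzClasses_le {𝓐 : Set (Set Plane)} {N : ℕ} (f : Fin N → Set Plane)
    (h : ∀ F ∈ 𝓐, ∃ j, LipschitzEquivalent F (f j)) : numLipschitzClasses 𝓐 ≤ N := by
  choose j hj using fun q : Quotient (lipschitzSetoid 𝓐) => h q.out q.out.2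
  have hinj : Function.Injective j := fun q q' hq => by
    rw [← q.out_eq, ← q'.out_eq]
    refine Quotient.sound ?_
    have h1 := hj q
    rw [hq] at h1
    exact h1.trans (hj q').symm
  refine (ENat.card_le_card_of_injective hinj).trans ?_
  simp

theorem one_le_numLipschitzClasses {𝓐 : Set (Set Plane)} {F : Set Plane} (hF : F ∈ 𝓐) :
    1 ≤ numLipschitzClasses 𝓐 := by
  rw [numLipschitzClasses, ENat.one_le_card_iff_nonempty]
  exact ⟨Quotient.mk _ ⟨F, hF⟩⟩

theorem two_le_numLipschitzClasses {𝓐 : Set (Set Plane)} {E F : Set Plane} (hE : E ∈ 𝓐)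
    (hF : F ∈ 𝓐) (h : ¬ LipschitzEquivalent E F) : 2 ≤ numLipschitzClasses 𝓐 := by
  have hnt : Nontrivial (Quotient (lipschitzSetoid 𝓐)) :=
    ⟨Quotient.mk _ ⟨E, hE⟩, Quotient.mk _ ⟨F, hF⟩, fun heq => h (Quotient.exact heq)⟩
  have h1 := (ENat.one_lt_card_iff_nontrivial _).2 hnt
  exact Order.add_one_le_of_lt h1

theorem numLipschitzClasses_fractalSquares_two : numLipschitzClasses (fractalSquares 3 2) = 1 := by
  refine le_antisymm ?_ ?_
  · refine numLipschitzClasses_le (N := 1) (fun _ => range (expand ![(0, 0), (1, 0)])) ?_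
    intro F hF
    obtain ⟨L, hL, hcard, hF⟩ := exists_digitList hF
    obtain ⟨v, hv, h⟩ := (hasPlacement_two L hL).exists_lipschitzEquivalent (by decide +kernel)
      hcard hF
    obtain rfl := List.mem_singleton.1 hv
    exact ⟨0, h⟩
  · exact one_le_numLipschitzClasses (F := range (expand ![(0, 0), (1, 0)]))
      (range_expand_mem_fractalSquares ![(0, 0), (1, 0)] (by decide) (by decide) (by decide))

theorem numLipschitzClasses_fractalSquares_three :
    numLipschitzClasses (fractalSquares 3 3) = 2 := by
  have hdust : IsDust 3 (range (expand ![(0, 0), (1, 0), (0, 1)])) :=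
    isDust_of_separated (W := 1) (n := 3) (by decide +kernel) (by decide +kernel)
  refine le_antisymm ?_ ?_
  · refine numLipschitzClasses_le (N := 2) ![range (expand ![(0, 0), (1, 0), (0, 1)]),
      range (expand ![(0, 0), (1, 0), (2, 0)])] ?_
    intro F hF
    obtain ⟨L, hL, hcard, hF⟩ := exists_digitList hF
    obtain ⟨v, hv, h⟩ := (hasPlacement_three L hL).exists_lipschitzEquivalent (by decide +kernel)
      hcard hF
    rcases List.mem_pair.1 hv with rfl | rfl
    · exact ⟨0, h⟩
    · exact ⟨1, h⟩
  · exact two_le_numLipschitzClasses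
      (range_expand_mem_fractalSquares ![(0, 0), (1, 0), (0, 1)] (by decide) (by decide)
        (by decide))
      (range_expand_mem_fractalSquares ![(0, 0), (1, 0), (2, 0)] (by decide) (by decide)
        (by decide))
      fun h => not_isDust_of_segment (v := ![(0, 0), (1, 0), (2, 0)]) (i := 0) (j := 1) (k := 2)
        rfl rfl rfl 3 (hdust.of_lipschitzEquivalent h)

theorem numLipschitzClasses_fractalSquares_four :
    numLipschitzClasses (fractalSquares 3 4) = 2 := by
  refine le_antisymm ?_ ?_
  · refine numLipschitzClasses_le (N := 2) ![range (expand ![(1, 2), (0, 0), (0, 1), (1, 0)]),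
      range (expand ![(2, 0), (0, 0), (1, 0), (0, 1)])] ?_
    intro F hF
    obtain ⟨L, hL, hcard, hF⟩ := exists_digitList hF
    obtain ⟨v, hv, h⟩ := (hasPlacement_four L hL).exists_lipschitzEquivalent (by decide +kernel)
      hcard hF
    simp only [List.mem_cons] at hv
    rcases hv with rfl | rfl | hv
    · exact ⟨1, h⟩
    · exact ⟨0, h⟩
    · exact ⟨0, h.trans ((isDust_of_mem_fourDigits hv).lipschitzEquivalent isDust_four)⟩
  · exact two_le_numLipschitzClasses
      (range_expand_mem_fractalSquares ![(1, 2), (0, 0), (0, 1), (1, 0)] (by decide) (by decide)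
        (by decide))
      (range_expand_mem_fractalSquares ![(2, 0), (0, 0), (1, 0), (0, 1)] (by decide) (by decide)
        (by decide))
      fun h => not_isDust_of_segment (v := ![(2, 0), (0, 0), (1, 0), (0, 1)])
        (i := 1) (j := 2) (k := 0) rfl rfl rfl 4 (isDust_four.of_lipschitzEquivalent h)

theorem numLipschitzClasses_fractalSquares_five :
    numLipschitzClasses (fractalSquares 3 5) ≤ 10 := by
  refine numLipschitzClasses_le (N := 10) (fun i => range (expand (fiveDigits.get i))) ?_
  intro F hF
  obtain ⟨L, hL, hcard, hF⟩ := exists_digitList hF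
  obtain ⟨v, hv, h⟩ := (hasPlacement_five L hL).exists_lipschitzEquivalent (by decide +kernel)
    hcard hF
  simp only [List.mem_cons] at hv
  rcases hv with rfl | rfl | rfl | hv
  · exact ⟨0, h.trans lipschitzEquivalent_same_side_opposite_sides⟩
  · exact ⟨9, h.trans (isDust_five_of_corners.lipschitzEquivalent isDust_five_of_cells)⟩
  · exact ⟨9, h.trans (isDust_five_of_pairs.lipschitzEquivalent isDust_five_of_cells)⟩
  · obtain ⟨i, rfl⟩ := List.mem_iff_get.1 hv
    exact ⟨i, h⟩

theorem theorem1p2 :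
    numLipschitzClasses (fractalSquares 3 2) = 1 ∧
    numLipschitzClasses (fractalSquares 3 3) = 2 ∧
    numLipschitzClasses (fractalSquares 3 4) = 2 ∧
    numLipschitzClasses (fractalSquares 3 5) ≤ 10 :=
  ⟨numLipschitzClasses_fractalSquares_two, numLipschitzClasses_fractalSquares_three,
    numLipschitzClasses_fractalSquares_four, numLipschitzClasses_fractalSquares_five⟩
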